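/- **Setting.** Let $K\ge 1$, $\mathcal A=\{1,\dots,K\}$, $\theta\in\mathbb R$. An instance $\nu=(\nu_a)_{a\in\mathcal A}$ consists of $1$-sub-Gaussian distributions on $\mathbb R$ with means $\mu=(\mu_a)_a$, i.e. $\mathbb E_{X\sim\nu_a}[e^{\lambda(X-\mu_a)}]\le e^{\lambda^2/2}$ for all $\lambda\in\mathbb R$. Put $\mathcal A_\theta=\{a:\mu_a\ge\theta\}$ (good arms), $\Delta_a=|\mu_a-\theta|$, $\Delta_{\min}=\min_a\Delta_a$, $H_1(\mu)=\sum_{a\in\mathcal A}\Delta_a^{-2}$, $H_\theta(\mu)=\sum_{a\in\mathcal A_\theta}\Delta_a^{-2}$. In round $t$ an arm $a_t$ is pulled and a reward is observed whose conditional distribution given the past and $a_t$ is $\nu_{a_t}$. Let $N_a(t)$ and $\hat\mu_a(t)$ be the number of pulls and the empirical mean of arm $a$ after $t$ rounds, $W_a^{+}(t)=\sqrt{N_a(t)}\,(\hat\mu_a(t)-\theta)_+$ and $W_a^{-}(t)=\sqrt{N_a(t)}\,(\theta-\hat\mu_a(t))_+$. **APGAI.** Each arm is pulled once in the first $K$ rounds.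 After $t\ge K$ rounds: if $\max_a\hat\mu_a(t)\le\theta$, recommend $\hat a_t=\emptyset$ and pull $a_{t+1}\in\arg\min_a W_a^-(t)$; otherwise recommend and pull $\hat a_t=a_{t+1}\in\arg\max_a W_a^+(t)$. Ties are broken arbitrarily, possibly at random. The sampling rule does not depend on $\delta$. **Stopping.** Let $\overline W_{-1}(x)=-W_{-1}(-e^{-x})$ for $x\ge1$, with $W_{-1}$ the negative branch of the Lambert function, and let $2c(t,\delta)=\overline W_{-1}\big(2\ln(K/\delta)+4\ln\ln(e^4t)+\tfrac12\big)$. The GLR stopping time $\tau_\delta$ is the first $t\ge K$ such that $\max_aW_a^+(t)\ge\sqrt{2c(t,\delta)}$ or $\min_aW_a^-(t)\ge\sqrt{2c(t,\delta)}$ ($\tau_\delta=\infty$ if there is none). **Constants.** Let $h_1(z,y)=z\,\overline W_{-1}(y/z+\log z)$, $T_\mu=h_1(54H_1(\mu),K)$, $S_\mu=h_1(12H_1(\mu),K+2|\mathcal A_\theta|)$, $$D_1(\mu)=T_\mu+2H_1(\mu)\big(\theta-\min_a\mu_a\big)^2-6H_1(\mu)\log T_\mu,\qquad D_\theta(\mu)=S_\mu+1-\frac{6\log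 S_\mu}{\max_{a\in\mathcal A_\theta}\Delta_a^2}.$$ Set $(H,D)=(H_1(\mu),D_1(\mu))$ if $\mathcal A_\theta=\emptyset$ and $(H,D)=(H_\theta(\mu),D_\theta(\mu))$ otherwise, and $$C_\mu(\delta)=\sup\Big\{t\in\mathbb N,\ t\ge1:\ t\le 2H\big(\sqrt{c(t,\delta)}+\sqrt{3\log t}\big)^2+D\Big\}.$$ **Theorem.** 1. APGAI with this stopping rule is $\delta$-correct: for every $\delta\in(0,1)$ and every $1$-sub-Gaussian instance, the probability that $\tau_\delta<\infty$ and $\hat a_{\tau_\delta}$ is wrong is at most $\delta$. Here $\hat a$ is wrong if $\mathcal A_\theta\ne\emptyset$ and $\hat a\notin\mathcal A_\theta$, or if $\mathcal A_\theta=\emptyset$ and $\hat a\ne\emptyset$. 2. For every $1$-sub-Gaussian instance with $\Delta_{\min}>0$ and every $\delta\in(0,1)$, the supremum $C_\mu(\delta)$ is finite (over a non-empty set) and $$\mathbb E_\nu[\tau_\delta]\le C_\mu(\delta)+\frac{K\pi^2}{6}+1 .$$ 3. For every $1$-sub-Gaussian instance with $\Delta_{\min}>0$, $\limsup_{\delta\to0}\mathbb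 E_\nu[\tau_\delta]/\log(1/\delta)\le 2H$, that is $2H_1(\mu)$ if there is no good arm and $2H_\theta(\mu)$ otherwise; moreover $C_\mu(\delta)=2H\log(1/\delta)+\mathcal O\big(\sqrt{\log(1/\delta)\log\log(1/\delta)}\big)$ as $\delta\to0$. 4. In particular, for Gaussian arms $\nu_a=\mathcal N(\mu_a,1)$ with $\mu_a<\theta$ for all $a$, $\limsup_{\delta\to0}\mathbb E_\nu[\tau_\delta]/\log(1/\delta)\le T^\star(\mu)$, where the characteristic time $T^\star(\mu)$ is $2H_1(\mu)$ if $\mathcal A_\theta=\emptyset$ and $2\min_{a\in\mathcal A_\theta}\Delta_a^{-2}$ otherwise (asymptotic optimality means $\delta$-correctness together with this inequality). 5. The constant $D$ is of order $H_1(\mu)\log H_1(\mu)$ when gaps are small: for all $K$ and $R$ there are $k_1,k_2>0$ such that $k_1H_1(\mu)\log H_1(\mu)\le D\le k_2H_1(\mu)\log H_1(\mu)$ for all $\theta$ and $\mu\in\mathbb R^K$ with $0<\Delta_a\le R$ for all $a$ and $H_1(\mu)\ge2$. -/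

import Mathlib

open MeasureTheory ProbabilityTheory Filter Topology Asymptotics
open scoped ENNReal NNReal

universe u

namespace GAI

/-! ### Instances -/

/-- The mean vector of a bandit instance. -/
noncomputable def mean {K : ℕ} (ν : Fin K → Measure ℝ) (a : Fin K) : ℝ := ∫ x, x ∂(ν a)

/-- Every arm has a `1`-sub-Gaussian distribution:
`E[exp (l (X - mean))] ≤ exp (l ^ 2 / 2)` for all real `l`, the expectation being finite. -/
def IsSubGaussianInstance {K : ℕ} (ν : Fin K → Measure ℝ) : Prop :=
  ∀ a, IsProbabilityMeasure (ν a) ∧ HasSubgaussianMGF (fun x => x - mean ν a) 1 (ν a)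

/-- The set of good arms for the threshold `θ`. -/
noncomputable def goodArms {K : ℕ} (θ : ℝ) (μ : Fin K → ℝ) : Finset (Fin K) :=
  Finset.univ.filter (fun a => θ ≤ μ a)

/-- The gap of an arm. -/
noncomputable def gap {K : ℕ} (θ : ℝ) (μ : Fin K → ℝ) (a : Fin K) : ℝ := |μ a - θ|

/-- `H₁(μ)`: sum of the inverse squared gaps over all arms. -/
noncomputable def H1 {K : ℕ} (θ : ℝ) (μ : Fin K → ℝ) : ℝ := ∑ a, ((gap θ μ a) ^ 2)⁻¹

/-- `H_θ(μ)`: sum of the inverse squared gaps over the good arms. -/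
noncomputable def Hθ {K : ℕ} (θ : ℝ) (μ : Fin K → ℝ) : ℝ :=
  ∑ a ∈ goodArms θ μ, ((gap θ μ a) ^ 2)⁻¹

/-- The complexity: `H₁(μ)` when there is no good arm and `H_θ(μ)` otherwise. -/
noncomputable def H {K : ℕ} (θ : ℝ) (μ : Fin K → ℝ) : ℝ :=
  open scoped Classical in if goodArms θ μ = ∅ then H1 θ μ else Hθ θ μ

/-- The characteristic time `T*(μ)`, which is the optimal asymptotic rate for Gaussian instances
with unit variance. -/
noncomputable def charTime {K : ℕ} (θ : ℝ) (μ : Fin K → ℝ) : ℝ :=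
  open scoped Classical in
  if goodArms θ μ = ∅ then 2 * H1 θ μ
  else 2 * sInf ((fun a => ((gap θ μ a) ^ 2)⁻¹) '' (goodArms θ μ : Set (Fin K)))

/-! ### Empirical quantities

A trajectory is a sequence of pulled arms `A` and of rewards `X`; the arm `A s` is the one pulled
in round `s + 1`, so that the first `t` rounds are the indices `s < t`. -/

/-- Number of pulls of arm `a` in the first `t` rounds. -/
def pulls {K : ℕ} (A : ℕ → Fin K) (a : Fin K) (t : ℕ) : ℕ :=
  ((Finset.range t).filter (fun s => A s = a)).card

/-- Empirical mean of arm `a` after `t` rounds. -/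
noncomputable def empMean {K : ℕ} (A : ℕ → Fin K) (X : ℕ → ℝ) (a : Fin K) (t : ℕ) : ℝ :=
  (∑ s ∈ (Finset.range t).filter (fun s => A s = a), X s) / (pulls A a t : ℝ)

/-- Empirical transportation cost in favour of `μ a > θ`. -/
noncomputable def Wplus {K : ℕ} (θ : ℝ) (A : ℕ → Fin K) (X : ℕ → ℝ) (a : Fin K) (t : ℕ) : ℝ :=
  √(pulls A a t : ℝ) * max (empMean A X a t - θ) 0

/-- Empirical transportation cost in favour of `μ a < θ`. -/
noncomputable def Wminus {K : ℕ} (θ : ℝ) (A : ℕ → Fin K) (X : ℕ → ℝ) (a : Fin K) (t : ℕ) : ℝ :=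
  √(pulls A a t : ℝ) * max (-(empMean A X a t - θ)) 0

/-! ### The algorithm -/

/-- The sampling rule on one trajectory: in the first `K` rounds every arm is pulled once
(in any order); after `t ≥ K` rounds the next arm minimises `W⁻` when no empirical mean exceeds
the threshold, and maximises `W⁺` otherwise. Ties are not resolved here. -/
def FollowsAPGAI {K : ℕ} (θ : ℝ) (A : ℕ → Fin K) (X : ℕ → ℝ) : Prop :=
  (∀ a, pulls A a K = 1) ∧
  ∀ t, K ≤ t →
    ((∀ a, empMean A X a t ≤ θ) → ∀ b, Wminus θ A X (A t) t ≤ Wminus θ A X b t) ∧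
    ((∃ a, θ < empMean A X a t) → ∀ b, Wplus θ A X b t ≤ Wplus θ A X (A t) t)

/-- The recommendation after `t` rounds (`none` is the answer "there is no good arm"): `none` when
no empirical mean exceeds the threshold, and the arm selected to be pulled next otherwise. -/
noncomputable def recommendation {K : ℕ} (θ : ℝ) (A : ℕ → Fin K) (X : ℕ → ℝ) (t : ℕ) :
    Option (Fin K) :=
  open scoped Classical in if ∀ a, empMean A X a t ≤ θ then none else some (A t)

/-- The error event: when there is a good arm, the recommendation is not a good arm; when there is
none, the recommendation is an arm. -/
def IsError {K : ℕ} (θ : ℝ) (μ : Fin K → ℝ) (r : Option (Fin K)) : Prop :=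
  ((goodArms θ μ).Nonempty ∧ ∀ a ∈ goodArms θ μ, r ≠ some a) ∨ (goodArms θ μ = ∅ ∧ r ≠ none)

/-- A run of the sampling rule on the instance `ν`, on a probability space `(Ω, P)`: the arms and
rewards are random variables; given the history of the first `t` rounds and the arm `a` pulled
next, the next reward has distribution `ν a`; and the trajectory follows the sampling rule
almost surely. Ties and the initial order may be resolved in any, possibly randomised, way. -/
structure IsAPGAIRun {K : ℕ} {Ω : Type*} [MeasurableSpace Ω] (P : Measure Ω) (θ : ℝ)
    (ν : Fin K → Measure ℝ) (A : ℕ → Ω → Fin K) (X : ℕ → Ω → ℝ) : Prop where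
  measurable_arm : ∀ t, Measurable (A t)
  measurable_reward : ∀ t, Measurable (X t)
  reward_law : ∀ (t : ℕ) (S : Set (Fin t → Fin K × ℝ)), MeasurableSet S →
    ∀ (a : Fin K) (B : Set ℝ), MeasurableSet B →
      P {ω | (fun s : Fin t => (A s ω, X s ω)) ∈ S ∧ A t ω = a ∧ X t ω ∈ B} =
        P {ω | (fun s : Fin t => (A s ω, X s ω)) ∈ S ∧ A t ω = a} * ν a B
  follows : ∀ᵐ ω ∂P, FollowsAPGAI θ (fun t => A t ω) (fun t => X t ω)

/-! ### Stopping rule and threshold -/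

/-- The negative branch `W₋₁` of the Lambert function on `[-1/e, 0)`: the inverse of
`w ↦ w * exp w` on `(-∞, -1]`. -/
noncomputable def lambertNeg (y : ℝ) : ℝ :=
  Function.invFunOn (fun w : ℝ => w * Real.exp w) (Set.Iic (-1)) y

/-- `x ↦ - W₋₁(- exp (-x))` for `x ≥ 1`. -/
noncomputable def Wbar (x : ℝ) : ℝ := - lambertNeg (- Real.exp (-x))

/-- The threshold:
`2 c(t, δ) = Wbar (2 log (K / δ) + 4 log (log (e ^ 4 * t)) + 1 / 2)`. -/
noncomputable def threshold (K t : ℕ) (δ : ℝ) : ℝ :=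
  Wbar (2 * Real.log (K / δ) + 4 * Real.log (Real.log (Real.exp 4 * t)) + 1 / 2) / 2

/-- First time `t ≥ K` at which `max_a W⁺ ≥ √(2 c(t, δ))` (`⊤` if there is none). -/
noncomputable def tauPlus {K : ℕ} (θ δ : ℝ) (A : ℕ → Fin K) (X : ℕ → ℝ) : ℕ∞ :=
  ⨅ t ∈ {t : ℕ | K ≤ t ∧ ∃ a, √(2 * threshold K t δ) ≤ Wplus θ A X a t}, (t : ℕ∞)

/-- First time `t ≥ K` at which `min_a W⁻ ≥ √(2 c(t, δ))` (`⊤` if there is none). -/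
noncomputable def tauMinus {K : ℕ} (θ δ : ℝ) (A : ℕ → Fin K) (X : ℕ → ℝ) : ℕ∞ :=
  ⨅ t ∈ {t : ℕ | K ≤ t ∧ ∀ a, √(2 * threshold K t δ) ≤ Wminus θ A X a t}, (t : ℕ∞)

/-- The GLR stopping time. -/
noncomputable def tau {K : ℕ} (θ δ : ℝ) (A : ℕ → Fin K) (X : ℕ → ℝ) : ℕ∞ :=
  min (tauPlus θ δ A X) (tauMinus θ δ A X)

/-- The expected sample complexity, in `[0, ∞]`. -/
noncomputable def expTau {K : ℕ} {Ω : Type*} [MeasurableSpace Ω] (P : Measure Ω) (θ δ : ℝ)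
    (A : ℕ → Ω → Fin K) (X : ℕ → Ω → ℝ) : ℝ≥0∞ :=
  ∫⁻ ω, ((tau θ δ (fun t => A t ω) (fun t => X t ω) : ℕ∞) : ℝ≥0∞) ∂P

/-! ### Constants of the bound -/

/-- `h₁(z, y) = z * Wbar (y / z + log z)`. -/
noncomputable def h1 (z y : ℝ) : ℝ := z * Wbar (y / z + Real.log z)

/-- `T_μ = h₁(54 H₁(μ), K)`. -/
noncomputable def Tμ {K : ℕ} (θ : ℝ) (μ : Fin K → ℝ) : ℝ := h1 (54 * H1 θ μ) K

/-- `S_μ = h₁(12 H₁(μ), K + 2 |A_θ|)`. -/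
noncomputable def Sμ {K : ℕ} (θ : ℝ) (μ : Fin K → ℝ) : ℝ :=
  h1 (12 * H1 θ μ) (K + 2 * ((goodArms θ μ).card : ℝ))

/-- `D₁(μ)`, used when there is no good arm. -/
noncomputable def D1 {K : ℕ} (θ : ℝ) (μ : Fin K → ℝ) : ℝ :=
  Tμ θ μ + 2 * H1 θ μ * (θ - ⨅ a, μ a) ^ 2 - 6 * H1 θ μ * Real.log (Tμ θ μ)

/-- `D_θ(μ)`, used when there is a good arm. -/
noncomputable def Dθ {K : ℕ} (θ : ℝ) (μ : Fin K → ℝ) : ℝ :=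
  Sμ θ μ + 1 - 6 * Real.log (Sμ θ μ) /
    sSup ((fun a => (gap θ μ a) ^ 2) '' (goodArms θ μ : Set (Fin K)))

/-- `D₁(μ)` when there is no good arm and `D_θ(μ)` otherwise. -/
noncomputable def D {K : ℕ} (θ : ℝ) (μ : Fin K → ℝ) : ℝ :=
  open scoped Classical in if goodArms θ μ = ∅ then D1 θ μ else Dθ θ μ

/-- The set of positive integers `t` (seen as reals) with
`t ≤ 2 H (√c(t, δ) + √(3 log t)) ^ 2 + D`. -/
def Cset {K : ℕ} (θ : ℝ) (μ : Fin K → ℝ) (δ : ℝ) : Set ℝ :=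
  {x | ∃ t : ℕ, 1 ≤ t ∧ x = t ∧
    (t : ℝ) ≤ 2 * H θ μ * (√(threshold K t δ) + √(3 * Real.log t)) ^ 2 + D θ μ}

/-- `C_μ(δ)`. -/
noncomputable def C {K : ℕ} (θ : ℝ) (μ : Fin K → ℝ) (δ : ℝ) : ℝ := sSup (Cset θ μ δ)

end GAI

open GAI

/-! Both branches of the sampling rule pull an arm of largest signed index `√N_a (μ̂_a - θ)`
(`FollowsAPGAI.signedIndex_le`). Up to a sign, this index is `√N_a Δ_a` minus the normalised
deviation of the arm in the misleading direction. The proof therefore splits into deterministic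
statements about one trajectory and probability bounds on deviations; the latter all come from one
Ville inequality for mixtures of exponential factors (`measure_exists_le_wealth`).

Correctness: a wrong answer at the stopping time forces some arm to deviate beyond the threshold
(`FollowsAPGAI.exists_deviation_of_isError`). A Gaussian mixture on each slice of sample sizes of
ratio `e^4`, followed by a union over slices, bounds this by `δ / K` per arm
(`measure_threshold_deviation_le`).

Sample complexity: let `n < τ` and write `q` for `radiusSq K n δ`. If deviations up to round `n` are
at most `√(6 log n)`, each arm counted in `H` has at most `1 + 2 q / Δ_a²` pulls
(`FollowsAPGAI.pulls_le_of_lt_tau`). When good arms exist, the bad arms need another argument,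
independent of `δ`: pulling one requires a joint deviation of it and of a fixed good arm, and
summing these probabilities leaves a deterministic number of pulls plus an excess `R` of mean at
most `1/4` (`IsAPGAIRun.exists_excess`). Pulls add up to `n`, so `n ≤ 2 H q + D - 1 + R`. Past an
integer `N > C`, however, `2 H q + D` lags behind `n` by more than `(n - N) / 4`
(`linear_growth_of_C_lt`), so outside the failure events at most `4 R` values of `n ≥ N` lie before
`τ`. Summing tail probabilities yields `C + Kπ²/6 + 1`.

The expansion of `C` is a bootstrap: a crude linear bound on the admissible `t` makes `log t` of
order `log log (1/δ)`, and this is fed back into the defining inequality. The order of `D` follows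
from the fixed-point equations of `Tμ` and `Sμ`. -/

namespace GAI

/-! ### The function `Wbar` -/

/-- From `log (b/a) < b/a - 1 ≤ b - a`, the last step because `a ≥ 1`. This monotonicity is what
lets `Wbar` be treated as the inverse of `y ↦ y - log y` on `[1, ∞)`. -/
theorem sub_log_lt_sub_log {a b : ℝ} (ha : 1 ≤ a) (hab : a < b) :
    a - Real.log a < b - Real.log b := by
  have ha0 : 0 < a := by linarith
  have hb0 : 0 < b := by linarith
  have h1 : Real.log (b / a) < b / a - 1 :=
    Real.log_lt_sub_one_of_pos (by positivity) (by
      intro h; rw [div_eq_one_iff_eq ha0.ne'] at h; linarith)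
  rw [Real.log_div hb0.ne' ha0.ne'] at h1
  have h2 : b / a - 1 ≤ b - a := by
    rw [div_sub_one ha0.ne', div_le_iff₀ ha0]
    nlinarith
  linarith

theorem sub_log_le_sub_log_iff {a b : ℝ} (ha : 1 ≤ a) (hb : 1 ≤ b) :
    a - Real.log a ≤ b - Real.log b ↔ a ≤ b := by
  constructor
  · intro h
    by_contra! hc
    linarith [sub_log_lt_sub_log hb hc]
  · intro h
    rcases h.eq_or_lt with rfl | h
    · exact le_rfl
    · exact (sub_log_lt_sub_log ha h).le

theorem exists_mul_exp_eq {x : ℝ} (hx : 1 ≤ x) :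
    ∃ w ∈ Set.Iic (-1 : ℝ), w * Real.exp w = -Real.exp (-x) := by
  have hc : ContinuousOn (fun y : ℝ => y - Real.log y) (Set.Icc 1 (2 * x)) := by
    apply ContinuousOn.sub continuousOn_id
    apply Real.continuousOn_log.mono
    intro y hy
    have := hy.1
    simp only [Set.mem_compl_iff, Set.mem_singleton_iff]
    linarith
  have hlog : Real.log (2 * x) ≤ x := by
    rw [Real.log_mul (by norm_num) (by linarith)]
    have := Real.log_le_sub_one_of_pos (show 0 < x by linarith)
    have := Real.log_two_lt_d9
    linarith
  have hmem : x ∈ Set.Icc ((1 : ℝ) - Real.log 1) (2 * x - Real.log (2 * x)) := by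
    constructor
    · simpa using hx
    · linarith
  obtain ⟨y, hy, hyx⟩ := intermediate_value_Icc (by linarith) hc hmem
  have hy0 : 0 < y := by linarith [hy.1]
  refine ⟨-y, by simpa using hy.1, ?_⟩
  have : -x = Real.log y - y := by simp only at hyx; linarith
  rw [this, Real.exp_sub, Real.exp_log hy0, Real.exp_neg]
  ring

/-- With `w = -y`, taking logarithms in `w e^w = -e^{-x}` gives `y - log y = x`. Later facts about
`Wbar` rest on this characterisation, not on the Lambert function. -/
theorem Wbar_spec {x : ℝ} (hx : 1 ≤ x) : 1 ≤ Wbar x ∧ Wbar x - Real.log (Wbar x) = x := by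
  have hex := exists_mul_exp_eq hx
  have hmem : -Real.exp (-x) ∈ (fun w : ℝ => w * Real.exp w) '' Set.Iic (-1) := by
    obtain ⟨w, hw, h⟩ := hex
    exact ⟨w, hw, h⟩
  have h1 : lambertNeg (-Real.exp (-x)) ∈ Set.Iic (-1 : ℝ) := Function.invFunOn_mem hmem
  have h2 : lambertNeg (-Real.exp (-x)) * Real.exp (lambertNeg (-Real.exp (-x)))
      = -Real.exp (-x) := Function.invFunOn_eq hmem
  have h3 : 1 ≤ Wbar x := by
    unfold Wbar
    have := Set.mem_Iic.1 h1
    linarith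
  refine ⟨h3, ?_⟩
  have h4 : Wbar x * Real.exp (-Wbar x) = Real.exp (-x) := by
    unfold Wbar
    rw [neg_neg]
    linarith
  have h5 := congrArg Real.log h4
  rw [Real.log_mul (by linarith) (Real.exp_pos _).ne', Real.log_exp, Real.log_exp] at h5
  linarith

theorem one_le_Wbar {x : ℝ} (hx : 1 ≤ x) : 1 ≤ Wbar x := (Wbar_spec hx).1

theorem Wbar_eq {x : ℝ} (hx : 1 ≤ x) : Wbar x = x + Real.log (Wbar x) := by
  linarith [(Wbar_spec hx).2]

theorem Wbar_le_iff {x y : ℝ} (hx : 1 ≤ x) (hy : 1 ≤ y) :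
    Wbar x ≤ y ↔ x ≤ y - Real.log y := by
  rw [← sub_log_le_sub_log_iff (one_le_Wbar hx) hy, (Wbar_spec hx).2]

theorem le_Wbar_iff {x y : ℝ} (hx : 1 ≤ x) (hy : 1 ≤ y) :
    y ≤ Wbar x ↔ y - Real.log y ≤ x := by
  rw [← sub_log_le_sub_log_iff hy (one_le_Wbar hx), (Wbar_spec hx).2]

theorem Wbar_mono {x y : ℝ} (hx : 1 ≤ x) (hxy : x ≤ y) : Wbar x ≤ Wbar y := by
  rw [Wbar_le_iff hx (one_le_Wbar (hx.trans hxy)), (Wbar_spec (hx.trans hxy)).2]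
  exact hxy

theorem le_Wbar {x : ℝ} (hx : 1 ≤ x) : x ≤ Wbar x := by
  rw [Wbar_eq hx]
  linarith [Real.log_nonneg (one_le_Wbar hx)]

theorem Wbar_le_two_mul {x : ℝ} (hx : 1 ≤ x) : Wbar x ≤ 2 * x := by
  rw [Wbar_le_iff hx (by linarith), Real.log_mul (by norm_num) (by linarith)]
  have := Real.log_le_sub_one_of_pos (show 0 < x by linarith)
  have := Real.log_two_lt_d9
  linarith

theorem Wbar_le_add_log {x : ℝ} (hx : 1 ≤ x) : Wbar x ≤ x + Real.log (2 * x) := by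
  have := Real.log_le_log (by linarith [one_le_Wbar hx]) (Wbar_le_two_mul hx)
  linarith [Wbar_eq hx]

/-- A concavity estimate for `Wbar`. -/
theorem Wbar_add_le {x h : ℝ} (hx : 1 ≤ x) (hW : 1 < Wbar x) (hh : 0 ≤ h) :
    Wbar (x + h) ≤ Wbar x + h * (Wbar x / (Wbar x - 1)) := by
  set y := Wbar x with hy
  have hy1 : 0 < y - 1 := by linarith
  have hy0 : 0 < y := by linarith
  have hnn : 0 ≤ h * (y / (y - 1)) := by positivity
  rw [Wbar_le_iff (by linarith) (by linarith)]
  -- The slope `y / (y - 1)` is the derivative of the inverse of `y - log y`; the estimate is the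
  -- tangent line of a concave function, obtained from `log (1 + u) ≤ u`.
  have hprod : y + h * (y / (y - 1)) = y * (1 + h / (y - 1)) := by
    field_simp
  have hlog : Real.log (y + h * (y / (y - 1))) ≤ Real.log y + h / (y - 1) := by
    rw [hprod, Real.log_mul hy0.ne' (by positivity)]
    have := Real.log_le_sub_one_of_pos (show 0 < 1 + h / (y - 1) by positivity)
    linarith
  have hid : h * (y / (y - 1)) = h + h / (y - 1) := by
    field_simp
    ring
  have := Wbar_eq hx
  rw [← hy] at this
  linarith

/-! ### The function `h1` -/

theorem one_le_div_add_log {z y : ℝ} (hz : 0 < z) (hy : 1 ≤ y) : 1 ≤ y / z + Real.log z := by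
  have h1 := Real.log_le_sub_one_of_pos (inv_pos.2 hz)
  rw [Real.log_inv] at h1
  have h2 : z⁻¹ ≤ y / z := by
    rw [inv_eq_one_div]
    gcongr
  linarith

theorem le_h1 {z y : ℝ} (hz : 0 < z) (hy : 1 ≤ y) : z ≤ h1 z y := by
  have := one_le_Wbar (one_le_div_add_log hz hy)
  unfold h1
  nlinarith

/-- The purpose of `h1`: it solves `h = y + z log h`, so `Tμ` and `Sμ` absorb a logarithm of
themselves. -/
theorem h1_eq {z y : ℝ} (hz : 0 < z) (hy : 1 ≤ y) : h1 z y = y + z * Real.log (h1 z y) := by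
  have h := one_le_div_add_log hz hy
  have hW := one_le_Wbar h
  have he := Wbar_eq h
  unfold h1
  rw [Real.log_mul hz.ne' (by linarith)]
  conv_lhs => rw [he]
  field_simp
  ring

theorem le_h1_right {z y : ℝ} (hz : 0 < z) (hy : 1 ≤ y) : y ≤ h1 z y := by
  have h := one_le_div_add_log hz hy
  unfold h1
  rw [← div_le_iff₀' hz]
  by_cases hc : 1 ≤ y / z
  · rw [le_Wbar_iff h hc, Real.log_div (by linarith) hz.ne']
    linarith [Real.log_nonneg hy]
  · linarith [one_le_Wbar h]

theorem h1_le {z y : ℝ} (hz : 0 < z) (hy : 1 ≤ y) : h1 z y ≤ 2 * (y + z * Real.log z) := by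
  have h := Wbar_le_two_mul (one_le_div_add_log hz hy)
  unfold h1
  calc z * Wbar (y / z + Real.log z) ≤ z * (2 * (y / z + Real.log z)) := by gcongr
    _ = 2 * (y + z * Real.log z) := by field_simp

/-! ### The threshold -/

theorem log_exp_four_mul {t : ℕ} (ht : 1 ≤ t) :
    Real.log (Real.exp 4 * t) = 4 + Real.log t := by
  rw [Real.log_mul (Real.exp_pos _).ne' (by positivity), Real.log_exp]

theorem log_nat_nonneg (t : ℕ) : 0 ≤ Real.log (t : ℝ) := Real.log_natCast_nonneg t

/-- The argument of `Wbar` in the definition of the threshold. -/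
noncomputable def thresholdArg (K t : ℕ) (δ : ℝ) : ℝ :=
  2 * Real.log (K / δ) + 4 * Real.log (4 + Real.log t) + 1 / 2

theorem two_mul_threshold {K t : ℕ} {δ : ℝ} (ht : 1 ≤ t) :
    2 * threshold K t δ = Wbar (thresholdArg K t δ) := by
  unfold threshold thresholdArg
  rw [log_exp_four_mul ht]
  ring

theorem log_div_nonneg {K : ℕ} (hK : 1 ≤ K) {δ : ℝ} (hδ : δ ∈ Set.Ioo (0 : ℝ) 1) :
    0 ≤ Real.log (K / δ) := by
  apply Real.log_nonneg
  rw [le_div_iff₀ hδ.1]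
  have : (1 : ℝ) ≤ K := by exact_mod_cast hK
  linarith [hδ.2]

theorem one_lt_log_four : 1.38 < Real.log 4 := by
  have : (4 : ℝ) = 2 ^ (2 : ℕ) := by norm_num
  rw [this, Real.log_pow]
  have := Real.log_two_gt_d9
  push_cast
  linarith

theorem log_four_le_log_four_add (t : ℕ) : Real.log 4 ≤ Real.log (4 + Real.log t) :=
  Real.log_le_log (by norm_num) (by linarith [log_nat_nonneg t])

theorem six_le_thresholdArg {K : ℕ} (hK : 1 ≤ K) {δ : ℝ} (hδ : δ ∈ Set.Ioo (0 : ℝ) 1) (t : ℕ) :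
    6 ≤ thresholdArg K t δ := by
  unfold thresholdArg
  linarith [log_div_nonneg hK hδ, log_four_le_log_four_add t, one_lt_log_four]

theorem thresholdArg_mono {K : ℕ} {δ : ℝ} {s t : ℕ} (hs : 1 ≤ s) (hst : s ≤ t) :
    thresholdArg K s δ ≤ thresholdArg K t δ := by
  unfold thresholdArg
  have h0 : (1 : ℝ) ≤ s := by exact_mod_cast hs
  have h1 : Real.log s ≤ Real.log t :=
    Real.log_le_log (by linarith) (by exact_mod_cast hst)
  have h2 : Real.log (4 + Real.log s) ≤ Real.log (4 + Real.log t) :=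
    Real.log_le_log (by linarith [log_nat_nonneg s]) (by linarith)
  linarith

theorem threshold_mono {K : ℕ} (hK : 1 ≤ K) {δ : ℝ} (hδ : δ ∈ Set.Ioo (0 : ℝ) 1) {s t : ℕ}
    (hs : 1 ≤ s) (hst : s ≤ t) : threshold K s δ ≤ threshold K t δ := by
  have h := Wbar_mono (by linarith [six_le_thresholdArg hK hδ s])
    (thresholdArg_mono (K := K) (δ := δ) hs hst)
  rw [← two_mul_threshold hs, ← two_mul_threshold (hs.trans hst)] at h
  linarith

theorem three_le_threshold {K : ℕ} (hK : 1 ≤ K) {δ : ℝ} (hδ : δ ∈ Set.Ioo (0 : ℝ) 1) {t : ℕ}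
    (ht : 1 ≤ t) : 3 ≤ threshold K t δ := by
  have h6 := six_le_thresholdArg hK hδ t
  have := le_Wbar (x := thresholdArg K t δ) (by linarith)
  rw [← two_mul_threshold ht] at this
  linarith

/-! ### Complexities -/

section Complexity

variable {K : ℕ} {θ : ℝ} {μ : Fin K → ℝ}

theorem gap_pos (hμ : ∀ a, μ a ≠ θ) (a : Fin K) : 0 < gap θ μ a :=
  abs_pos.2 (sub_ne_zero.2 (hμ a))

theorem inv_gap_sq_pos (hμ : ∀ a, μ a ≠ θ) (a : Fin K) : 0 < ((gap θ μ a) ^ 2)⁻¹ := by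
  have := gap_pos hμ a
  positivity

/-- The arms over which the complexity sums the inverse squared gaps. -/
noncomputable def relevantArms {K : ℕ} (θ : ℝ) (μ : Fin K → ℝ) : Finset (Fin K) :=
  open scoped Classical in if goodArms θ μ = ∅ then Finset.univ else goodArms θ μ

theorem H_eq_sum : H θ μ = ∑ a ∈ relevantArms θ μ, ((gap θ μ a) ^ 2)⁻¹ := by
  unfold H relevantArms
  split_ifs <;> rfl

theorem relevantArms_nonempty (hK : 1 ≤ K) : (relevantArms θ μ).Nonempty := by
  unfold relevantArms
  split_ifs with h
  · exact ⟨⟨0, hK⟩, Finset.mem_univ _⟩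
  · exact Finset.nonempty_iff_ne_empty.2 h

theorem H_pos (hK : 1 ≤ K) (hμ : ∀ a, μ a ≠ θ) : 0 < H θ μ := by
  rw [H_eq_sum]
  exact Finset.sum_pos (fun a _ => inv_gap_sq_pos hμ a) (relevantArms_nonempty hK)

theorem sum_inv_gap_sq_le_H1 (hμ : ∀ a, μ a ≠ θ) (s : Finset (Fin K)) :
    ∑ a ∈ s, ((gap θ μ a) ^ 2)⁻¹ ≤ H1 θ μ :=
  Finset.sum_le_sum_of_subset_of_nonneg (Finset.subset_univ s)
    (fun a _ _ => (inv_gap_sq_pos hμ a).le)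

theorem H_le_H1 (hμ : ∀ a, μ a ≠ θ) : H θ μ ≤ H1 θ μ := by
  rw [H_eq_sum]
  exact sum_inv_gap_sq_le_H1 hμ _

theorem H1_pos (hK : 1 ≤ K) (hμ : ∀ a, μ a ≠ θ) : 0 < H1 θ μ :=
  (H_pos hK hμ).trans_le (H_le_H1 hμ)

theorem inv_gap_sq_le_H1 (hμ : ∀ a, μ a ≠ θ) (a : Fin K) : ((gap θ μ a) ^ 2)⁻¹ ≤ H1 θ μ := by
  simpa using sum_inv_gap_sq_le_H1 hμ {a}

theorem H1_eq_H_add : H1 θ μ = H θ μ + ∑ a ∈ (relevantArms θ μ)ᶜ, ((gap θ μ a) ^ 2)⁻¹ := by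
  rw [H_eq_sum, Finset.sum_add_sum_compl]
  rfl

/-! ### The constants `Tμ` and `Sμ` -/

theorem Tμ_eq (hK : 1 ≤ K) (hμ : ∀ a, μ a ≠ θ) :
    Tμ θ μ = K + 54 * H1 θ μ * Real.log (Tμ θ μ) := by
  have := H1_pos hK hμ
  exact h1_eq (by positivity) (by exact_mod_cast hK)

theorem le_Tμ (hK : 1 ≤ K) (hμ : ∀ a, μ a ≠ θ) : K ≤ Tμ θ μ ∧ 54 * H1 θ μ ≤ Tμ θ μ := by
  have := H1_pos hK hμ
  exact ⟨le_h1_right (by positivity) (by exact_mod_cast hK),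
    le_h1 (by positivity) (by exact_mod_cast hK)⟩

theorem one_le_Sμ_arg (hK : 1 ≤ K) : (1 : ℝ) ≤ K + 2 * ((goodArms θ μ).card : ℝ) := by
  have : (1 : ℝ) ≤ K := by exact_mod_cast hK
  have : (0 : ℝ) ≤ (goodArms θ μ).card := Nat.cast_nonneg _
  linarith

theorem Sμ_eq (hK : 1 ≤ K) (hμ : ∀ a, μ a ≠ θ) :
    Sμ θ μ = K + 2 * ((goodArms θ μ).card : ℝ) + 12 * H1 θ μ * Real.log (Sμ θ μ) := by
  have := H1_pos hK hμ
  exact h1_eq (by positivity) (one_le_Sμ_arg hK)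

theorem le_Sμ (hK : 1 ≤ K) (hμ : ∀ a, μ a ≠ θ) :
    K + 2 * ((goodArms θ μ).card : ℝ) ≤ Sμ θ μ ∧ 12 * H1 θ μ ≤ Sμ θ μ := by
  have := H1_pos hK hμ
  exact ⟨le_h1_right (by positivity) (one_le_Sμ_arg hK), le_h1 (by positivity) (one_le_Sμ_arg hK)⟩

theorem three_le_Sμ (hK : 1 ≤ K) (hμ : ∀ a, μ a ≠ θ) (hg : (goodArms θ μ).Nonempty) :
    3 ≤ Sμ θ μ := by
  have h1 : (1 : ℝ) ≤ (goodArms θ μ).card := by exact_mod_cast hg.card_pos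
  have h2 : (1 : ℝ) ≤ K := by exact_mod_cast hK
  linarith [(le_Sμ hK hμ).1]

theorem one_le_log_Sμ (hK : 1 ≤ K) (hμ : ∀ a, μ a ≠ θ) (hg : (goodArms θ μ).Nonempty) :
    1 ≤ Real.log (Sμ θ μ) := by
  rw [Real.le_log_iff_exp_le (by linarith [three_le_Sμ hK hμ hg])]
  linarith [three_le_Sμ hK hμ hg, Real.exp_one_lt_d9]

/-! ### The constant `D` -/

theorem D_of_empty (h : goodArms θ μ = ∅) : D θ μ = D1 θ μ := by
  unfold D; rw [if_pos h]

theorem D_of_nonempty (h : (goodArms θ μ).Nonempty) : D θ μ = Dθ θ μ := by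
  unfold D; rw [if_neg h.ne_empty]

theorem relevantArms_of_empty (h : goodArms θ μ = ∅) : relevantArms θ μ = Finset.univ := by
  unfold relevantArms; rw [if_pos h]

theorem relevantArms_of_nonempty (h : (goodArms θ μ).Nonempty) :
    relevantArms θ μ = goodArms θ μ := by
  unfold relevantArms; rw [if_neg h.ne_empty]

theorem H_of_empty (h : goodArms θ μ = ∅) : H θ μ = H1 θ μ := by
  unfold H; rw [if_pos h]

/-- Since `54 = 9 * 6`, the fixed-point equation turns the subtracted term `6 H₁ log Tμ` into a
ninth of `Tμ - K`. -/
theorem D1_eq (hK : 1 ≤ K) (hμ : ∀ a, μ a ≠ θ) :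
    D1 θ μ = Tμ θ μ + 2 * H1 θ μ * (θ - ⨅ a, μ a) ^ 2 - (Tμ θ μ - K) / 9 := by
  have := Tμ_eq hK hμ
  unfold D1
  linarith

theorem exists_iInf_gap (hK : 1 ≤ K) (hg : goodArms θ μ = ∅) :
    ∃ a, gap θ μ a = θ - ⨅ a, μ a := by
  have : Nonempty (Fin K) := ⟨⟨0, hK⟩⟩
  obtain ⟨a, ha⟩ := exists_eq_ciInf_of_finite (f := μ)
  refine ⟨a, ?_⟩
  have hlt : μ a < θ := by
    by_contra! hc
    have : a ∈ goodArms θ μ := Finset.mem_filter.2 ⟨Finset.mem_univ a, hc⟩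
    rw [hg] at this
    simp at this
  rw [← ha, gap, abs_of_neg (by linarith)]
  ring

/-- The arm of lowest mean contributes `Δ⁻²` to `H₁`, so `2 H₁ (θ - min μ)²` is at least `2`; the
rest is at least `K` because `Tμ ≥ K`. -/
theorem add_two_le_D1 (hK : 1 ≤ K) (hμ : ∀ a, μ a ≠ θ) (hg : goodArms θ μ = ∅) :
    K + 2 ≤ D1 θ μ := by
  obtain ⟨a, ha⟩ := exists_iInf_gap hK hg
  rw [D1_eq hK hμ, ← ha]
  have h1 := inv_gap_sq_le_H1 hμ a
  have h2 := gap_pos hμ a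
  have h3 : 1 ≤ H1 θ μ * gap θ μ a ^ 2 := by
    rw [← div_le_iff₀ (by positivity), one_div]
    exact h1
  linarith [(le_Tμ hK hμ).1]

theorem Dθ_correction_le (hK : 1 ≤ K) (hμ : ∀ a, μ a ≠ θ) (hg : (goodArms θ μ).Nonempty) :
    0 ≤ 6 * Real.log (Sμ θ μ) / sSup ((fun a => (gap θ μ a) ^ 2) '' (goodArms θ μ : Set (Fin K))) ∧
    6 * Real.log (Sμ θ μ) / sSup ((fun a => (gap θ μ a) ^ 2) '' (goodArms θ μ : Set (Fin K)))
      ≤ 6 * H θ μ * Real.log (Sμ θ μ) := by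
  have hlog := one_le_log_Sμ hK hμ hg
  obtain ⟨a, ha⟩ := hg
  set M := sSup ((fun a => (gap θ μ a) ^ 2) '' (goodArms θ μ : Set (Fin K)))
  have hM : gap θ μ a ^ 2 ≤ M :=
    le_csSup ((Finset.finite_toSet _).image _).bddAbove ⟨a, ha, rfl⟩
  have hgap := gap_pos hμ a
  have hM0 : 0 < M := lt_of_lt_of_le (by positivity) hM
  refine ⟨by positivity, ?_⟩
  have hH : (gap θ μ a ^ 2)⁻¹ ≤ H θ μ := by
    rw [H_eq_sum, relevantArms_of_nonempty ⟨a, ha⟩]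
    exact Finset.single_le_sum (f := fun a => (gap θ μ a ^ 2)⁻¹)
      (fun b _ => (inv_gap_sq_pos hμ b).le) ha
  have hinv : M⁻¹ ≤ H θ μ := (inv_anti₀ (by positivity) hM).trans hH
  rw [div_eq_mul_inv]
  nlinarith

/-- The additive constant dominates the number of initial pulls and the cost of the arms that do
not enter the complexity. -/
theorem le_D (hK : 1 ≤ K) (hμ : ∀ a, μ a ≠ θ) :
    K + 12 * (H1 θ μ - H θ μ) * Real.log (Sμ θ μ) + 1 ≤ D θ μ := by
  rcases (goodArms θ μ).eq_empty_or_nonempty with hg | hg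
  · rw [D_of_empty hg, H_of_empty hg]
    linarith [add_two_le_D1 hK hμ hg]
  · rw [D_of_nonempty hg, Dθ]
    have h1 := (Dθ_correction_le hK hμ hg).2
    have h2 := Sμ_eq hK hμ
    have h3 : 0 ≤ H θ μ * Real.log (Sμ θ μ) :=
      mul_nonneg (H_pos hK hμ).le (by linarith [one_le_log_Sμ hK hμ hg])
    have h4 : (0 : ℝ) ≤ (goodArms θ μ).card := Nat.cast_nonneg _
    linarith

theorem three_le_D (hK : 1 ≤ K) (hμ : ∀ a, μ a ≠ θ) : 3 ≤ D θ μ := by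
  have hK' : (1 : ℝ) ≤ K := by exact_mod_cast hK
  rcases (goodArms θ μ).eq_empty_or_nonempty with hg | hg
  · rw [D_of_empty hg]
    linarith [add_two_le_D1 hK hμ hg]
  · rw [D_of_nonempty hg, Dθ]
    have h1 := (Dθ_correction_le hK hμ hg).2
    have h2 := Sμ_eq hK hμ
    have h3 : H θ μ * Real.log (Sμ θ μ) ≤ H1 θ μ * Real.log (Sμ θ μ) :=
      mul_le_mul_of_nonneg_right (H_le_H1 hμ) (by linarith [one_le_log_Sμ hK hμ hg])
    have h4 : (1 : ℝ) ≤ (goodArms θ μ).card := by exact_mod_cast hg.card_pos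
    have h5 : 0 ≤ H1 θ μ * Real.log (Sμ θ μ) :=
      mul_nonneg (H1_pos hK hμ).le (by linarith [one_le_log_Sμ hK hμ hg])
    linarith

/-- The squared deviation scale in the definition of `C`. -/
noncomputable def radiusSq (K t : ℕ) (δ : ℝ) : ℝ :=
  (√(threshold K t δ) + √(3 * Real.log t)) ^ 2

theorem radiusSq_nonneg (K t : ℕ) (δ : ℝ) : 0 ≤ radiusSq K t δ := sq_nonneg _

theorem one_mem_Cset (hK : 1 ≤ K) (hμ : ∀ a, μ a ≠ θ) (δ : ℝ) : (1 : ℝ) ∈ Cset θ μ δ := by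
  refine ⟨1, le_rfl, by simp, ?_⟩
  have h1 := three_le_D hK hμ
  have h2 := H_pos hK hμ
  have h3 := radiusSq_nonneg K 1 δ
  unfold radiusSq at h3
  have := mul_nonneg (mul_nonneg zero_le_two h2.le) h3
  push_cast at this ⊢
  linarith

theorem log_div_eq (hK : 1 ≤ K) {δ : ℝ} (hδ : δ ∈ Set.Ioo (0 : ℝ) 1) :
    Real.log (K / δ) = Real.log K + Real.log (1 / δ) := by
  rw [Real.log_div (by positivity) hδ.1.ne', Real.log_div one_ne_zero hδ.1.ne', Real.log_one]
  ring

theorem log_one_div_pos {δ : ℝ} (hδ : δ ∈ Set.Ioo (0 : ℝ) 1) : 0 < Real.log (1 / δ) := by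
  apply Real.log_pos
  rw [lt_div_iff₀ hδ.1]
  linarith [hδ.2]

theorem thresholdArg_le (hK : 1 ≤ K) {δ : ℝ} (hδ : δ ∈ Set.Ioo (0 : ℝ) 1) (t : ℕ) :
    thresholdArg K t δ ≤
      2 * Real.log (1 / δ) + 2 * Real.log K + 4 * Real.log t + 25 / 2 := by
  unfold thresholdArg
  rw [log_div_eq hK hδ]
  have := Real.log_le_sub_one_of_pos (show 0 < 4 + Real.log t by linarith [log_nat_nonneg t])
  linarith

theorem log_one_div_le_threshold (hK : 1 ≤ K) {δ : ℝ} (hδ : δ ∈ Set.Ioo (0 : ℝ) 1) {t : ℕ}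
    (ht : 1 ≤ t) : Real.log (1 / δ) ≤ threshold K t δ := by
  have h := le_Wbar (x := thresholdArg K t δ) (by linarith [six_le_thresholdArg hK hδ t])
  rw [← two_mul_threshold ht] at h
  have : 2 * Real.log (1 / δ) ≤ thresholdArg K t δ := by
    unfold thresholdArg
    rw [log_div_eq hK hδ]
    linarith [log_nat_nonneg K, log_four_le_log_four_add t, one_lt_log_four]
  linarith

/-- Every element of `Cset` is at most linear in `log (1 / δ)`. -/
theorem exists_Cset_le (hK : 1 ≤ K) (hμ : ∀ a, μ a ≠ θ) :
    ∃ M, ∀ δ ∈ Set.Ioo (0 : ℝ) 1, ∀ x ∈ Cset θ μ δ, x ≤ 16 * H θ μ * Real.log (1 / δ) + M := by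
  have hH := H_pos hK hμ
  refine ⟨2 * (2 * H θ μ * (4 * Real.log K + 25) + 28 * H θ μ * (Real.log (56 * H θ μ) - 1)
    + D θ μ), ?_⟩
  rintro δ hδ x ⟨t, ht, rfl, hx⟩
  have ht0 : (0 : ℝ) < t := by positivity
  have hL := log_nat_nonneg t
  have hc := three_le_threshold hK hδ ht
  have hq : (√(threshold K t δ) + √(3 * Real.log t)) ^ 2
      ≤ 2 * threshold K t δ + 6 * Real.log t := by
    have h1 := Real.sq_sqrt (show 0 ≤ threshold K t δ by linarith)
    have h2 := Real.sq_sqrt (show 0 ≤ 3 * Real.log t by linarith)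
    nlinarith [sq_nonneg (√(threshold K t δ) - √(3 * Real.log t))]
  have hW := Wbar_le_two_mul (x := thresholdArg K t δ) (by linarith [six_le_thresholdArg hK hδ t])
  rw [← two_mul_threshold ht] at hW
  have harg := thresholdArg_le hK hδ t
  -- Tangent of `log` at `56 H`: the total coefficient of `log t` is `28 H`, so the linear part
  -- costs exactly `t / 2` and is absorbed on the left.
  have hlog : Real.log t ≤ t / (56 * H θ μ) - 1 + Real.log (56 * H θ μ) := by
    have h1 := Real.log_le_sub_one_of_pos (show 0 < t / (56 * H θ μ) by positivity)
    rw [Real.log_div ht0.ne' (by positivity)] at h1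
    linarith
  have hlog' : 28 * H θ μ * Real.log t
      ≤ t / 2 + 28 * H θ μ * (Real.log (56 * H θ μ) - 1) := by
    calc 28 * H θ μ * Real.log t
        ≤ 28 * H θ μ * (t / (56 * H θ μ) - 1 + Real.log (56 * H θ μ)) := by gcongr
      _ = _ := by field_simp; ring
  have hq2 : 2 * H θ μ * (√(threshold K t δ) + √(3 * Real.log t)) ^ 2
      ≤ 2 * H θ μ * (4 * Real.log (1 / δ) + 4 * Real.log K + 25 + 14 * Real.log t) := by
    gcongr
    linarith
  linarith

theorem bddAbove_Cset (hK : 1 ≤ K) (hμ : ∀ a, μ a ≠ θ) {δ : ℝ} (hδ : δ ∈ Set.Ioo (0 : ℝ) 1) :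
    BddAbove (Cset θ μ δ) := by
  obtain ⟨M, hM⟩ := exists_Cset_le hK hμ
  exact ⟨_, fun x hx => hM δ hδ x hx⟩

theorem isLUB_C (hK : 1 ≤ K) (hμ : ∀ a, μ a ≠ θ) {δ : ℝ} (hδ : δ ∈ Set.Ioo (0 : ℝ) 1) :
    IsLUB (Cset θ μ δ) (C θ μ δ) :=
  isLUB_csSup ⟨1, one_mem_Cset hK hμ δ⟩ (bddAbove_Cset hK hμ hδ)

/-! ### Growth of the bound in time -/

/-- With `t = s (1 + r)`, both `log t` and `c(t, δ)` grow by a factor at most `1 + 3r/4`. For the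
logarithm this uses `log s ≥ 4/3`, hence `s ≥ 4`. A factor strictly below `1 + r` is what makes the
slack linear in `linear_growth_of_C_lt`. -/
theorem radiusSq_le_mul (hK : 1 ≤ K) {δ : ℝ} (hδ : δ ∈ Set.Ioo (0 : ℝ) 1) {s t : ℕ}
    (hs : 4 ≤ s) (hst : s ≤ t) :
    radiusSq K t δ ≤ (1 + 3 / 4 * (((t : ℝ) - s) / s)) * radiusSq K s δ := by
  have hs' : (4 : ℝ) ≤ s := by exact_mod_cast hs
  have hst' : (s : ℝ) ≤ t := by exact_mod_cast hst
  set r : ℝ := ((t : ℝ) - s) / s with hr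
  have hr0 : 0 ≤ r := div_nonneg (by linarith) (by linarith)
  have htr : (t : ℝ) = s * (1 + r) := by rw [hr]; field_simp; ring
  have hLs : 4 / 3 ≤ Real.log s :=
    le_trans (by linarith [one_lt_log_four]) (Real.log_le_log (by norm_num) hs')
  have hLt : Real.log t ≤ Real.log s + r := by
    rw [htr, Real.log_mul (by linarith) (by linarith)]
    linarith [Real.log_le_sub_one_of_pos (show 0 < 1 + r by linarith)]
  have hLmono : Real.log s ≤ Real.log t := Real.log_le_log (by linarith) hst'
  have hL : Real.log t ≤ (1 + 3 / 4 * r) * Real.log s := by nlinarith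
  have hc : threshold K t δ ≤ (1 + 3 / 4 * r) * threshold K s δ := by
    have h6 := six_le_thresholdArg hK hδ s
    set x := thresholdArg K s δ with hx
    set h : ℝ := 4 * (Real.log (4 + Real.log t) - Real.log (4 + Real.log s)) with hh
    have hxt : thresholdArg K t δ = x + h := by
      rw [hx, hh]; unfold thresholdArg; ring
    have hh0 : 0 ≤ h := by
      have := Real.log_le_log (show 0 < 4 + Real.log s by linarith)
        (show 4 + Real.log s ≤ 4 + Real.log t by linarith)
      linarith
    -- The factor `4` in front of the iterated logarithm is cancelled by the `4` inside it.
    have hhr : h ≤ r := by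
      have h4 : 0 < 4 + Real.log s := by linarith
      have h1 := Real.log_le_sub_one_of_pos
        (show 0 < (4 + Real.log t) / (4 + Real.log s) by
          apply div_pos <;> linarith)
      rw [Real.log_div (by linarith) (by linarith)] at h1
      have h2 : (4 + Real.log t) / (4 + Real.log s) - 1 ≤ r / 4 := by
        rw [div_sub_one h4.ne', div_le_iff₀ h4]
        nlinarith
      linarith
    have hW6 : 6 ≤ Wbar x := h6.trans (le_Wbar (by linarith))
    have hadd := Wbar_add_le (x := x) (h := h) (by linarith) (by linarith) hh0
    rw [← hxt, ← two_mul_threshold (by omega), ← two_mul_threshold (by omega)] at hadd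
    have hy : 2 * threshold K s δ = Wbar x := two_mul_threshold (by omega)
    set y := 2 * threshold K s δ with hydef
    -- Far from tight: `y ≥ 6`, so the left side is at most `6/5`.
    have hfrac : y / (y - 1) ≤ 3 / 4 * y := by
      rw [div_le_iff₀ (by linarith)]
      nlinarith
    have : h * (y / (y - 1)) ≤ r * (3 / 4 * y) := by
      apply mul_le_mul hhr hfrac _ hr0
      apply div_nonneg <;> linarith
    have hy2 : threshold K s δ = y / 2 := by rw [hydef]; ring
    rw [hy2]
    linarith
  have h1r : 0 ≤ 1 + 3 / 4 * r := by linarith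
  have e1 : √(threshold K t δ) ≤ √(1 + 3 / 4 * r) * √(threshold K s δ) := by
    rw [← Real.sqrt_mul h1r]
    exact Real.sqrt_le_sqrt hc
  have e2 : √(3 * Real.log t) ≤ √(1 + 3 / 4 * r) * √(3 * Real.log s) := by
    rw [← Real.sqrt_mul h1r]
    apply Real.sqrt_le_sqrt
    linarith
  unfold radiusSq
  calc (√(threshold K t δ) + √(3 * Real.log t)) ^ 2
      ≤ (√(1 + 3 / 4 * r) * (√(threshold K s δ) + √(3 * Real.log s))) ^ 2 := by
        rw [mul_add]
        gcongr
    _ = _ := by rw [mul_pow, Real.sq_sqrt h1r]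

/-- Beyond `C`, the gap between `t` and the right-hand side of the defining inequality grows
linearly. -/
theorem linear_growth_of_C_lt (hK : 1 ≤ K) (hμ : ∀ a, μ a ≠ θ) {δ : ℝ}
    (hδ : δ ∈ Set.Ioo (0 : ℝ) 1) {N t : ℕ} (hN : C θ μ δ < N) (ht : N ≤ t) :
    2 * H θ μ * radiusSq K t δ + D θ μ + (t - N) / 4 < t := by
  have hlub := isLUB_C hK hμ hδ
  have hH := H_pos hK hμ
  have hD := three_le_D hK hμ
  have hC1 : 1 ≤ C θ μ δ := hlub.1 (one_mem_Cset hK hμ δ)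
  have hN1 : 1 ≤ N := by
    have : (1 : ℝ) < N := by linarith
    exact_mod_cast this.le
  have hgN : 2 * H θ μ * radiusSq K N δ + D θ μ < N := by
    by_contra! hc
    have : (N : ℝ) ∈ Cset θ μ δ := ⟨N, hN1, rfl, hc⟩
    linarith [hlub.1 this]
  have hq0 := mul_nonneg (mul_nonneg zero_le_two hH.le) (radiusSq_nonneg K N δ)
  -- The bound `D ≥ 3` serves to reach the range `N ≥ 4` where `radiusSq_le_mul` applies.
  have hN4 : 4 ≤ N := by
    have : (3 : ℝ) < N := by linarith
    have : 3 < N := by exact_mod_cast this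
    omega
  have hq := radiusSq_le_mul hK hδ hN4 ht
  have hN0 : (0 : ℝ) < N := by positivity
  have ht' : (N : ℝ) ≤ t := by exact_mod_cast ht
  have hr0 : 0 ≤ ((t : ℝ) - N) / N := div_nonneg (by linarith) hN0.le
  set r := ((t : ℝ) - N) / N with hr
  have hrN : r * N = t - N := by rw [hr]; field_simp
  have hmul : 2 * H θ μ * radiusSq K t δ
      ≤ (1 + 3 / 4 * r) * (2 * H θ μ * radiusSq K N δ) := by
    calc 2 * H θ μ * radiusSq K t δ
        ≤ 2 * H θ μ * ((1 + 3 / 4 * r) * radiusSq K N δ) := by gcongr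
      _ = _ := by ring
  -- As `r N = t - N` and `D ≥ 0`, adding `D` to the right side gives at most `N + 3 (t - N) / 4 = t
  -- - (t - N) / 4`.
  have hlt : (1 + 3 / 4 * r) * (2 * H θ μ * radiusSq K N δ) < (1 + 3 / 4 * r) * (N - D θ μ) := by
    apply mul_lt_mul_of_pos_left _ (by linarith)
    linarith
  nlinarith

/-! ### First-order expansion -/

/-- The integer part of `2 H log (1/δ)`, when positive, is admissible because `c(t, δ) ≥ log (1/δ)`
and `D ≥ 0`. -/
theorem sub_one_le_C (hK : 1 ≤ K) (hμ : ∀ a, μ a ≠ θ) {δ : ℝ} (hδ : δ ∈ Set.Ioo (0 : ℝ) 1) :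
    2 * H θ μ * Real.log (1 / δ) - 1 ≤ C θ μ δ := by
  have hlub := isLUB_C hK hμ hδ
  have hH := H_pos hK hμ
  have hl := log_one_div_pos hδ
  set x := 2 * H θ μ * Real.log (1 / δ) with hx
  have hx0 : 0 ≤ x := by positivity
  by_cases h1 : 1 ≤ ⌊x⌋₊
  · have hmem : ((⌊x⌋₊ : ℕ) : ℝ) ∈ Cset θ μ δ := by
      refine ⟨⌊x⌋₊, h1, rfl, ?_⟩
      have h2 := Nat.floor_le hx0
      have h3 := log_one_div_le_threshold hK hδ h1
      have h4 : threshold K ⌊x⌋₊ δ ≤ (√(threshold K ⌊x⌋₊ δ) + √(3 * Real.log ⌊x⌋₊)) ^ 2 := by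
        have h5 := Real.sq_sqrt (show 0 ≤ threshold K ⌊x⌋₊ δ by linarith)
        have h6 := Real.sqrt_nonneg (threshold K ⌊x⌋₊ δ)
        have h7 := Real.sqrt_nonneg (3 * Real.log ⌊x⌋₊)
        nlinarith
      have h5 : x ≤ 2 * H θ μ * (√(threshold K ⌊x⌋₊ δ) + √(3 * Real.log ⌊x⌋₊)) ^ 2 := by
        rw [hx]
        gcongr
        linarith
      linarith [three_le_D hK hμ]
    linarith [hlub.1 hmem, Nat.lt_floor_add_one x]
  · have : x < 1 := by
      by_contra! hc
      exact h1 (Nat.le_floor (by simpa using hc))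
    linarith [hlub.1 (one_mem_Cset hK hμ δ)]

/-- Bootstrap with `l = log (1/δ)`: `exists_Cset_le` gives `t = O(l)`, hence `log t = O(log l)` and
`c(t, δ) ≤ l + O(log l)`. The dominant error is the cross term `2 √(c · 3 log t)` of the square, of
order `√(l log l)`. -/
theorem exists_C_le (hK : 1 ≤ K) (hμ : ∀ a, μ a ≠ θ) :
    ∃ M, ∀ δ ∈ Set.Ioo (0 : ℝ) 1, 3 ≤ Real.log (1 / δ) →
      C θ μ δ ≤ 2 * H θ μ * Real.log (1 / δ)
        + M * √(Real.log (1 / δ) * Real.log (Real.log (1 / δ))) := by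
  obtain ⟨M₀, hM₀⟩ := exists_Cset_le hK hμ
  have hH := H_pos hK hμ
  set M₁ : ℝ := 16 * H θ μ + |M₀| + 1 with hM₁
  have hM₁1 : 1 ≤ M₁ := by rw [hM₁]; linarith [abs_nonneg M₀]
  set a : ℝ := Real.log M₁ + 1 with ha
  have ha1 : 1 ≤ a := by linarith [Real.log_nonneg hM₁1]
  set b : ℝ := 2 * Real.log K + 4 * a + 25 / 2 with hb
  have hb1 : 1 ≤ b := by linarith [log_nat_nonneg K]
  set e : ℝ := b + (Real.log (2 * (2 + b)) + 1) with he
  have he1 : 1 ≤ e := by linarith [Real.log_nonneg (show 1 ≤ 2 * (2 + b) by linarith)]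
  refine ⟨2 * H θ μ * (e + 3 * a + 2 * √((1 + e) * (3 * a))) + |D θ μ|, ?_⟩
  intro δ hδ hl3
  have hl : 3 ≤ Real.log (1 / δ) := hl3
  set l := Real.log (1 / δ) with hldef
  have hlogl : 1 ≤ Real.log l := by
    rw [Real.le_log_iff_exp_le (by linarith)]
    linarith [Real.exp_one_lt_d9]
  have hlogle : Real.log l ≤ l := by
    linarith [Real.log_le_sub_one_of_pos (show 0 < l by linarith)]
  set w := √(l * Real.log l) with hw
  have hlw : Real.log l ≤ w := by
    rw [hw]
    apply Real.le_sqrt_of_sq_le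
    nlinarith
  apply (isLUB_C hK hμ hδ).2
  rintro x hx
  have hx0 := hM₀ δ hδ x hx
  obtain ⟨t, ht, rfl, hxt⟩ := hx
  have ht1 : (1 : ℝ) ≤ t := by exact_mod_cast ht
  have htM : (t : ℝ) ≤ M₁ * l := by
    have : M₀ ≤ |M₀| * l := by
      have := le_abs_self M₀
      have := abs_nonneg M₀
      nlinarith
    rw [hM₁]
    linarith
  have hLt : Real.log t ≤ a * Real.log l := by
    have h1 : Real.log t ≤ Real.log M₁ + Real.log l := by
      rw [← Real.log_mul (by linarith) (by linarith)]
      exact Real.log_le_log (by linarith) htM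
    have h2 : Real.log M₁ ≤ Real.log M₁ * Real.log l :=
      le_mul_of_one_le_right (Real.log_nonneg hM₁1) hlogl
    rw [ha]
    linarith
  have harg : thresholdArg K t δ ≤ 2 * l + b * Real.log l := by
    have h1 := thresholdArg_le hK hδ t
    have h2 : 2 * Real.log K + 25 / 2 ≤ (2 * Real.log K + 25 / 2) * Real.log l :=
      le_mul_of_one_le_right (by linarith [log_nat_nonneg K]) hlogl
    rw [hb]
    linarith
  have h6 := six_le_thresholdArg hK hδ t
  have hlogarg : Real.log (2 * thresholdArg K t δ)
      ≤ (Real.log (2 * (2 + b)) + 1) * Real.log l := by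
    have h1 : 2 * thresholdArg K t δ ≤ 2 * (2 + b) * l := by nlinarith
    have h2 := Real.log_le_log (by linarith) h1
    rw [Real.log_mul (x := 2 * (2 + b)) (by linarith) (by linarith)] at h2
    have h3 : Real.log (2 * (2 + b)) ≤ Real.log (2 * (2 + b)) * Real.log l :=
      le_mul_of_one_le_right (Real.log_nonneg (by linarith)) hlogl
    linarith
  have hc : threshold K t δ ≤ l + e * Real.log l := by
    have h1 := Wbar_le_add_log (x := thresholdArg K t δ) (by linarith)
    rw [← two_mul_threshold ht] at h1
    have h2 : e * Real.log l = b * Real.log l + (Real.log (2 * (2 + b)) + 1) * Real.log l := by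
      rw [he]; ring
    have h3 : 0 ≤ e * Real.log l := by positivity
    linarith
  have hc0 := three_le_threshold hK hδ ht
  have hc' : threshold K t δ ≤ (1 + e) * l := by nlinarith
  have hprod : √(threshold K t δ) * √(3 * Real.log t) ≤ √((1 + e) * (3 * a)) * w := by
    rw [hw, ← Real.sqrt_mul (by linarith), ← Real.sqrt_mul (by positivity)]
    apply Real.sqrt_le_sqrt
    calc threshold K t δ * (3 * Real.log t)
        ≤ ((1 + e) * l) * (3 * (a * Real.log l)) := by
          apply mul_le_mul hc' (by linarith) (by linarith [log_nat_nonneg t]) (by positivity)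
      _ = _ := by ring
  have hsq : (√(threshold K t δ) + √(3 * Real.log t)) ^ 2
      ≤ l + (e + 3 * a + 2 * √((1 + e) * (3 * a))) * w := by
    have h1 := Real.sq_sqrt (show 0 ≤ threshold K t δ by linarith)
    have h2 := Real.sq_sqrt (show 0 ≤ 3 * Real.log t by linarith [log_nat_nonneg t])
    have h3 : (e + 3 * a) * Real.log l ≤ (e + 3 * a) * w := by gcongr
    have h4 : (√(threshold K t δ) + √(3 * Real.log t)) ^ 2 = threshold K t δ + 3 * Real.log t
      + 2 * (√(threshold K t δ) * √(3 * Real.log t)) := by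
      rw [add_sq, h1, h2]; ring
    rw [h4]
    linarith
  have hD : D θ μ ≤ |D θ μ| * w :=
    (le_abs_self _).trans (le_mul_of_one_le_right (abs_nonneg _) (hlogl.trans hlw))
  calc (t : ℝ) ≤ 2 * H θ μ * (√(threshold K t δ) + √(3 * Real.log t)) ^ 2 + D θ μ := hxt
    _ ≤ 2 * H θ μ * (l + (e + 3 * a + 2 * √((1 + e) * (3 * a))) * w) + |D θ μ| * w := by
      gcongr
    _ = _ := by ring

theorem tendsto_log_one_div : Tendsto (fun δ : ℝ => Real.log (1 / δ)) (𝓝[>] 0) atTop := by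
  have : (fun δ : ℝ => Real.log (1 / δ)) = fun δ => Real.log δ⁻¹ := by
    funext δ; rw [one_div]
  rw [this]
  exact Real.tendsto_log_atTop.comp tendsto_inv_nhdsGT_zero

theorem eventually_mem_Ioo_and_le (M : ℝ) :
    ∀ᶠ δ : ℝ in 𝓝[>] 0, δ ∈ Set.Ioo (0 : ℝ) 1 ∧ M ≤ Real.log (1 / δ) :=
  Eventually.and (Ioo_mem_nhdsGT one_pos) (tendsto_log_one_div.eventually_ge_atTop M)

theorem C_isBigO (hK : 1 ≤ K) (hμ : ∀ a, μ a ≠ θ) :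
    (fun δ : ℝ => C θ μ δ - 2 * H θ μ * Real.log (1 / δ)) =O[𝓝[>] 0]
      (fun δ : ℝ => √(Real.log (1 / δ) * Real.log (Real.log (1 / δ)))) := by
  obtain ⟨M, hM⟩ := exists_C_le hK hμ
  apply IsBigO.of_bound (|M| + 1)
  filter_upwards [eventually_mem_Ioo_and_le 3] with δ hδ
  have hub := hM δ hδ.1 hδ.2
  have hlb := sub_one_le_C hK hμ hδ.1
  set l := Real.log (1 / δ)
  have hl3 : 3 ≤ l := hδ.2
  have hlogl : 1 ≤ Real.log l := by
    rw [Real.le_log_iff_exp_le (by linarith)]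
    linarith [Real.exp_one_lt_d9]
  have hw1 : 1 ≤ √(l * Real.log l) := by
    apply Real.le_sqrt_of_sq_le
    nlinarith
  rw [Real.norm_eq_abs, Real.norm_eq_abs, abs_of_nonneg (Real.sqrt_nonneg _), abs_le]
  have h1 : M * √(l * Real.log l) ≤ |M| * √(l * Real.log l) := by
    gcongr; exact le_abs_self M
  have h2 : 0 ≤ |M| * √(l * Real.log l) := by positivity
  constructor <;> linarith

theorem tendsto_C_div_log (hK : 1 ≤ K) (hμ : ∀ a, μ a ≠ θ) (B : ℝ) :
    Tendsto (fun δ : ℝ => (C θ μ δ + B) / Real.log (1 / δ)) (𝓝[>] 0) (𝓝 (2 * H θ μ)) := by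
  have hlittle : (fun l : ℝ => √(l * Real.log l)) =o[atTop] (fun l : ℝ => l) := by
    rw [isLittleO_iff]
    intro c hc
    have h := (isLittleO_iff.1 Real.isLittleO_log_id_atTop) (show 0 < c ^ 2 by positivity)
    filter_upwards [h, eventually_ge_atTop 1] with l hl hl1
    rw [Real.norm_eq_abs, Real.norm_eq_abs, abs_of_nonneg (Real.sqrt_nonneg _),
      abs_of_nonneg (by linarith)]
    rw [Real.norm_eq_abs, Real.norm_eq_abs, id, abs_of_nonneg (Real.log_nonneg hl1),
      abs_of_nonneg (by linarith)] at hl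
    apply Real.sqrt_le_iff.2
    constructor
    · positivity
    · nlinarith
  have h1 := (C_isBigO hK hμ).trans_isLittleO (hlittle.comp_tendsto tendsto_log_one_div)
  have h2 : Tendsto (fun δ : ℝ => (C θ μ δ - 2 * H θ μ * Real.log (1 / δ)) / Real.log (1 / δ))
      (𝓝[>] 0) (𝓝 0) := h1.tendsto_div_nhds_zero
  have h3 : Tendsto (fun δ : ℝ => B / Real.log (1 / δ)) (𝓝[>] 0) (𝓝 0) :=
    tendsto_log_one_div.const_div_atTop B
  have h4 := (h2.add h3).add_const (2 * H θ μ)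
  rw [zero_add, zero_add] at h4
  refine h4.congr' ?_
  filter_upwards [eventually_mem_Ioo_and_le 1] with δ hδ
  have : Real.log (1 / δ) ≠ 0 := by linarith [hδ.2]
  field_simp
  ring

/-! ### Order of the additive constant -/

theorem iInf_gap_le {R : ℝ} (hK : 1 ≤ K) (hR : ∀ a, gap θ μ a ≤ R) (hg : goodArms θ μ = ∅) :
    (θ - ⨅ a, μ a) ^ 2 ≤ R ^ 2 := by
  obtain ⟨a, ha⟩ := exists_iInf_gap hK hg
  rw [← ha]
  exact pow_le_pow_left₀ (abs_nonneg _) (hR a) 2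

theorem log_mul_H1_le {c : ℝ} (hc : 1 ≤ c) (hH : 2 ≤ H1 θ μ) :
    c * H1 θ μ * Real.log (c * H1 θ μ)
      ≤ c * (2 * Real.log c + 1) * (H1 θ μ * Real.log (H1 θ μ)) := by
  have hlog : 1 / 2 ≤ Real.log (H1 θ μ) :=
    le_trans (by linarith [Real.log_two_gt_d9]) (Real.log_le_log two_pos hH)
  rw [Real.log_mul (by linarith) (by linarith)]
  have h1 : Real.log c + Real.log (H1 θ μ) ≤ (2 * Real.log c + 1) * Real.log (H1 θ μ) := by
    nlinarith [Real.log_nonneg hc]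
  calc c * H1 θ μ * (Real.log c + Real.log (H1 θ μ))
      ≤ c * H1 θ μ * ((2 * Real.log c + 1) * Real.log (H1 θ μ)) := by gcongr
    _ = _ := by ring

/-- The `12 H₁ log S` contained in `S = Sμ` loses at most `6 H log S ≤ 6 H₁ log S` to the correction
term, and `S ≥ H₁`. Without good arms, `8/9` of `54 H₁ log T` remains, with `T = Tμ`. -/
theorem D_lower (hK : 1 ≤ K) (hμ : ∀ a, μ a ≠ θ) (hH : 2 ≤ H1 θ μ) :
    6 * (H1 θ μ * Real.log (H1 θ μ)) ≤ D θ μ := by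
  have hH0 : 0 < H1 θ μ := by linarith
  have hlog : 0 ≤ Real.log (H1 θ μ) := Real.log_nonneg (by linarith)
  have hK' : (1 : ℝ) ≤ K := by exact_mod_cast hK
  rcases (goodArms θ μ).eq_empty_or_nonempty with hg | hg
  · rw [D_of_empty hg, D1_eq hK hμ]
    have h1 := Tμ_eq hK hμ
    have h2 := Real.log_le_log hH0 (show H1 θ μ ≤ Tμ θ μ by linarith [(le_Tμ hK hμ).2])
    have h3 : H1 θ μ * Real.log (H1 θ μ) ≤ H1 θ μ * Real.log (Tμ θ μ) := by gcongr
    have h4 : 0 ≤ H1 θ μ * Real.log (H1 θ μ) := by positivity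
    have h5 : 0 ≤ 2 * H1 θ μ * (θ - ⨅ a, μ a) ^ 2 := by positivity
    linarith
  · rw [D_of_nonempty hg, Dθ]
    have h1 := Sμ_eq hK hμ
    have h2 := Real.log_le_log hH0 (show H1 θ μ ≤ Sμ θ μ by linarith [(le_Sμ hK hμ).2])
    have h3 : H1 θ μ * Real.log (H1 θ μ) ≤ H1 θ μ * Real.log (Sμ θ μ) := by gcongr
    have h4 := (Dθ_correction_le hK hμ hg).2
    have h5 : H θ μ * Real.log (Sμ θ μ) ≤ H1 θ μ * Real.log (Sμ θ μ) :=
      mul_le_mul_of_nonneg_right (H_le_H1 hμ) (by linarith)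
    have h6 : (0 : ℝ) ≤ (goodArms θ μ).card := Nat.cast_nonneg _
    linarith

theorem D_upper {R : ℝ} (hK : 1 ≤ K) (hμ : ∀ a, μ a ≠ θ) (hR : ∀ a, gap θ μ a ≤ R)
    (hH : 2 ≤ H1 θ μ) :
    D θ μ ≤ (6 * K + 2 * (54 * (2 * Real.log 54 + 1)) + 4 * R ^ 2 + 1)
      * (H1 θ μ * Real.log (H1 θ μ)) := by
  have hH0 : 0 < H1 θ μ := by linarith
  have hlog : 1 / 2 ≤ Real.log (H1 θ μ) :=
    le_trans (by linarith [Real.log_two_gt_d9]) (Real.log_le_log two_pos hH)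
  have hK' : (1 : ℝ) ≤ K := by exact_mod_cast hK
  have hHlog : H1 θ μ ≤ 2 * (H1 θ μ * Real.log (H1 θ μ)) := by nlinarith
  set Λ := H1 θ μ * Real.log (H1 θ μ) with hΛ
  have hΛ1 : 1 ≤ Λ := by linarith
  have hKΛ : (K : ℝ) ≤ K * Λ := le_mul_of_one_le_right (by linarith) hΛ1
  rcases (goodArms θ μ).eq_empty_or_nonempty with hg | hg
  · rw [D_of_empty hg, D1_eq hK hμ]
    have h1 : Tμ θ μ ≤ 2 * (K + 54 * H1 θ μ * Real.log (54 * H1 θ μ)) :=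
      h1_le (by positivity) hK'
    have h2 := log_mul_H1_le (θ := θ) (μ := μ) (c := 54) (by norm_num) hH
    have h3 : 2 * H1 θ μ * (θ - ⨅ a, μ a) ^ 2 ≤ 2 * (2 * Λ) * R ^ 2 :=
      mul_le_mul (by linarith) (iInf_gap_le hK hR hg) (sq_nonneg _) (by linarith)
    have h4 := (le_Tμ hK hμ).1
    have : 0 ≤ (K : ℝ) * Λ := by positivity
    linarith
  · rw [D_of_nonempty hg, Dθ]
    have h1 : Sμ θ μ ≤ 2 * (K + 2 * ((goodArms θ μ).card : ℝ)
        + 12 * H1 θ μ * Real.log (12 * H1 θ μ)) :=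
      h1_le (by positivity) (one_le_Sμ_arg hK)
    have hcard : ((goodArms θ μ).card : ℝ) ≤ K := by
      have := Finset.card_le_univ (goodArms θ μ)
      rw [Fintype.card_fin] at this
      exact_mod_cast this
    have h2 := log_mul_H1_le (θ := θ) (μ := μ) (c := 54) (by norm_num) hH
    have h3 : 12 * H1 θ μ * Real.log (12 * H1 θ μ) ≤ 54 * H1 θ μ * Real.log (54 * H1 θ μ) := by
      have : Real.log (12 * H1 θ μ) ≤ Real.log (54 * H1 θ μ) :=
        Real.log_le_log (by positivity) (by linarith)
      have : 0 ≤ Real.log (12 * H1 θ μ) := Real.log_nonneg (by linarith)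
      gcongr
      norm_num
    have h4 := (Dθ_correction_le hK hμ hg).1
    have h5 : 0 ≤ R ^ 2 * Λ := by positivity
    linarith

end Complexity

/-! ### Mixture wealth as a function of the history. -/

section History

variable {K : ℕ} {Ω : Type*} {A : ℕ → Ω → Fin K} {X : ℕ → Ω → ℝ} {Λ : Type*} [MeasurableSpace Λ]
  {π : Measure Λ} {G : Λ → Fin K → ℝ → ℝ≥0∞}

/-- The history of the first `t` rounds. -/
def history (A : ℕ → Ω → Fin K) (X : ℕ → Ω → ℝ) (t : ℕ) (ω : Ω) : Fin t → Fin K × ℝ :=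
  fun s => (A s ω, X s ω)

/-- The mixture over `π` of the products of the factors `G` along a trajectory. -/
noncomputable def wealth (π : Measure Λ) (G : Λ → Fin K → ℝ → ℝ≥0∞) (A : ℕ → Fin K) (X : ℕ → ℝ)
    (t : ℕ) : ℝ≥0∞ :=
  ∫⁻ l, ∏ s ∈ Finset.range t, G l (A s) (X s) ∂π

theorem measurable_prod_history (hG : Measurable fun p : Λ × Fin K × ℝ => G p.1 p.2.1 p.2.2)
    (t : ℕ) : Measurable fun p : (Fin t → Fin K × ℝ) × Λ =>
      ∏ s : Fin t, G p.2 (p.1 s).1 (p.1 s).2 := by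
  apply Finset.measurable_prod
  intro s _
  have : Measurable fun p : (Fin t → Fin K × ℝ) × Λ => (p.2, p.1 s) :=
    measurable_snd.prodMk ((measurable_pi_apply s).comp measurable_fst)
  exact hG.comp this

/-- The wealth as a function of the history. -/
noncomputable def wealthOf (π : Measure Λ) (G : Λ → Fin K → ℝ → ℝ≥0∞) (t : ℕ)
    (h : Fin t → Fin K × ℝ) : ℝ≥0∞ :=
  ∫⁻ l, ∏ s : Fin t, G l (h s).1 (h s).2 ∂π

theorem measurable_wealthOf [SFinite π]
    (hG : Measurable fun p : Λ × Fin K × ℝ => G p.1 p.2.1 p.2.2) (t : ℕ) :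
    Measurable (wealthOf π G t) :=
  (measurable_prod_history hG t).lintegral_prod_right'

theorem wealth_eq (t : ℕ) (ω : Ω) :
    wealth π G (fun s => A s ω) (fun s => X s ω) t = wealthOf π G t (history A X t ω) := by
  unfold wealth wealthOf
  congr 1
  funext l
  rw [Finset.prod_range]
  rfl

end History

/-! ### Ville's inequality along a run. -/

section Ville

variable {K : ℕ} {Ω : Type*} [MeasurableSpace Ω] {P : Measure Ω} {θ : ℝ}
  {ν : Fin K → Measure ℝ} {A : ℕ → Ω → Fin K} {X : ℕ → Ω → ℝ}
  {Λ : Type*} [MeasurableSpace Λ] {π : Measure Λ} {G : Λ → Fin K → ℝ → ℝ≥0∞}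

theorem IsAPGAIRun.measurable_history (h : IsAPGAIRun P θ ν A X) (t : ℕ) :
    Measurable (history A X t) :=
  measurable_pi_lambda _ fun s => (h.measurable_arm s).prodMk (h.measurable_reward s)

theorem IsAPGAIRun.measurableSet_arm (h : IsAPGAIRun P θ ν A X) (t : ℕ) (a : Fin K) :
    MeasurableSet {ω | A t ω = a} :=
  h.measurable_arm t (measurableSet_singleton a)

/-- Given the history and the arm pulled next, the next reward is distributed as that arm. -/
theorem IsAPGAIRun.lintegral_next [IsProbabilityMeasure P] [∀ a, IsProbabilityMeasure (ν a)]
    (h : IsAPGAIRun P θ ν A X) (t : ℕ) (a : Fin K) {f : (Fin t → Fin K × ℝ) × ℝ → ℝ≥0∞}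
    (hf : Measurable f) :
    ∫⁻ ω in {ω | A t ω = a}, f (history A X t ω, X t ω) ∂P
      = ∫⁻ ω in {ω | A t ω = a}, ∫⁻ x, f (history A X t ω, x) ∂ν a ∂P := by
  have hm := h.measurable_history t
  have hX := h.measurable_reward t
  have hlaw : (P.restrict {ω | A t ω = a}).map (fun ω => (history A X t ω, X t ω))
      = ((P.restrict {ω | A t ω = a}).map (history A X t)).prod (ν a) := by
    symm
    apply Measure.prod_eq
    intro S B hS hB
    rw [Measure.map_apply (hm.prodMk hX) (hS.prod hB), Measure.map_apply hm hS,
      Measure.restrict_apply ((hm.prodMk hX) (hS.prod hB)), Measure.restrict_apply (hm hS)]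
    refine Eq.trans ?_ (h.reward_law t S hS a B hB)
    congr 1
    ext ω
    change ((history A X t ω ∈ S ∧ X t ω ∈ B) ∧ A t ω = a) ↔
      (history A X t ω ∈ S ∧ A t ω = a ∧ X t ω ∈ B)
    tauto
  rw [← lintegral_map hf (hm.prodMk hX), hlaw, lintegral_prod _ hf.aemeasurable,
    lintegral_map hf.lintegral_prod_right' hm]

/-- The supermartingale property, tested on events of the first `t` rounds. On `{A t = a}` the new
reward is integrated against `ν a`, and after exchanging this integral with the mixture the new
factor has mean at most one. -/
theorem setLIntegral_wealth_succ_le [IsProbabilityMeasure P] [∀ a, IsProbabilityMeasure (ν a)]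
    [SFinite π] (h : IsAPGAIRun P θ ν A X)
    (hG : Measurable fun p : Λ × Fin K × ℝ => G p.1 p.2.1 p.2.2)
    (hG1 : ∀ l a, ∫⁻ x, G l a x ∂ν a ≤ 1) (t : ℕ) {S : Set (Fin t → Fin K × ℝ)}
    (hS : MeasurableSet S) :
    ∫⁻ ω in history A X t ⁻¹' S, wealth π G (fun s => A s ω) (fun s => X s ω) (t + 1) ∂P
      ≤ ∫⁻ ω in history A X t ⁻¹' S, wealth π G (fun s => A s ω) (fun s => X s ω) t ∂P := by
  classical
  have hm := h.measurable_history t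
  have hS' : MeasurableSet (history A X t ⁻¹' S) := hm hS
  have hsum : ∀ F : Ω → ℝ≥0∞, ∫⁻ ω in history A X t ⁻¹' S, F ω ∂P
      = ∑ a, ∫⁻ ω in {ω | A t ω = a}, (history A X t ⁻¹' S).indicator F ω ∂P := by
    intro F
    rw [← lintegral_indicator hS',
      ← lintegral_biUnion_finset _ (fun a _ => h.measurableSet_arm t a)]
    · rw [← setLIntegral_univ]
      congr 2
      ext ω
      simp
    · intro a _ b _ hab
      rw [Function.onFun, Set.disjoint_left]
      intro ω (h1 : A t ω = a) (h2 : A t ω = b)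
      exact hab (h1.symm.trans h2)
  rw [hsum, hsum]
  apply Finset.sum_le_sum
  intro a _
  have hGa : Measurable fun p : Λ × ℝ => G p.1 a p.2 := by
    have : Measurable fun p : Λ × ℝ => (p.1, a, p.2) :=
      measurable_fst.prodMk (measurable_const.prodMk measurable_snd)
    exact hG.comp this
  have hfm : Measurable fun q : ((Fin t → Fin K × ℝ) × ℝ) × Λ =>
      (∏ s : Fin t, G q.2 (q.1.1 s).1 (q.1.1 s).2) * G q.2 a q.1.2 := by
    apply Measurable.mul
    · exact (measurable_prod_history hG t).comp
        ((measurable_fst.comp measurable_fst).prodMk measurable_snd)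
    · exact hGa.comp (measurable_snd.prodMk (measurable_snd.comp measurable_fst))
  set f : (Fin t → Fin K × ℝ) × ℝ → ℝ≥0∞ := fun p => S.indicator (fun _ =>
    ∫⁻ l, (∏ s : Fin t, G l (p.1 s).1 (p.1 s).2) * G l a p.2 ∂π) p.1 with hf
  have hfmeas : Measurable f := by
    have h1 : Measurable fun p : (Fin t → Fin K × ℝ) × ℝ =>
        ∫⁻ l, (∏ s : Fin t, G l (p.1 s).1 (p.1 s).2) * G l a p.2 ∂π := hfm.lintegral_prod_right'
    have h2 : f = (Prod.fst ⁻¹' S).indicator fun p : (Fin t → Fin K × ℝ) × ℝ =>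
        ∫⁻ l, (∏ s : Fin t, G l (p.1 s).1 (p.1 s).2) * G l a p.2 ∂π := by
      funext p
      simp only [hf, Set.indicator_apply, Set.mem_preimage]
    rw [h2]
    exact h1.indicator (measurable_fst hS)
  have hleft : ∫⁻ ω in {ω | A t ω = a}, (history A X t ⁻¹' S).indicator
      (fun ω => wealth π G (fun s => A s ω) (fun s => X s ω) (t + 1)) ω ∂P
      = ∫⁻ ω in {ω | A t ω = a}, f (history A X t ω, X t ω) ∂P := by
    apply setLIntegral_congr_fun (h.measurableSet_arm t a)
    intro ω hω
    have hω' : A t ω = a := hω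
    simp only [hf, Set.indicator_apply, Set.mem_preimage, wealth, Finset.prod_range_succ, hω',
      Finset.prod_range]
    rfl
  rw [hleft, h.lintegral_next t a hfmeas]
  apply lintegral_mono
  intro ω
  simp only [hf, Set.indicator_apply, Set.mem_preimage]
  split_ifs with hω
  · have hsw : Measurable fun q : ℝ × Λ =>
        (∏ s : Fin t, G q.2 (history A X t ω s).1 (history A X t ω s).2) * G q.2 a q.1 := by
      have : Measurable fun q : ℝ × Λ => ((history A X t ω, q.1), q.2) :=
        (measurable_const.prodMk measurable_fst).prodMk measurable_snd
      exact hfm.comp this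
    rw [lintegral_lintegral_swap hsw.aemeasurable, wealth_eq, wealthOf]
    apply lintegral_mono
    intro l
    simp only
    rw [lintegral_const_mul]
    · exact mul_le_of_le_one_right' (hG1 l a)
    · exact hGa.comp (measurable_const.prodMk measurable_id)
  · simp

/-- **Ville's inequality** for mixtures of products of factors with mean at most one. -/
theorem measure_exists_le_wealth [IsProbabilityMeasure P] [∀ a, IsProbabilityMeasure (ν a)]
    [IsProbabilityMeasure π] (h : IsAPGAIRun P θ ν A X)
    (hG : Measurable fun p : Λ × Fin K × ℝ => G p.1 p.2.1 p.2.2)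
    (hG1 : ∀ l a, ∫⁻ x, G l a x ∂ν a ≤ 1) (x : ℝ≥0∞) :
    x * P {ω | ∃ t, x ≤ wealth π G (fun s => A s ω) (fun s => X s ω) t} ≤ 1 := by
  set M : ℕ → Ω → ℝ≥0∞ := fun t ω => wealth π G (fun s => A s ω) (fun s => X s ω) t with hM
  have hMm : ∀ t, Measurable (M t) := by
    intro t
    have : M t = fun ω => wealthOf π G t (history A X t ω) := by
      funext ω; exact wealth_eq t ω
    rw [this]
    exact (measurable_wealthOf hG t).comp (h.measurable_history t)
  set V : ℕ → Set Ω := fun t => {ω | ∃ s < t, x ≤ M s ω} with hV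
  -- Not having crossed before `t` is an event of the history.
  have hVm : ∀ t, ∃ S : Set (Fin t → Fin K × ℝ), MeasurableSet S ∧
      (V t)ᶜ = history A X t ⁻¹' S := by
    intro t
    refine ⟨⋂ s : Fin t, {g | wealthOf π G s (fun r : Fin s => g (Fin.castLE s.2.le r)) < x},
      ?_, ?_⟩
    · apply MeasurableSet.iInter
      intro s
      apply measurableSet_lt _ measurable_const
      apply (measurable_wealthOf hG s).comp
      exact measurable_pi_lambda _ fun r => measurable_pi_apply _
    · ext ω
      simp only [hV, hM, Set.mem_compl_iff, Set.mem_ofPred_eq, not_exists, not_and, not_le,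
        Set.mem_preimage, Set.mem_iInter]
      constructor
      · intro h1 s
        have := h1 s s.2
        rw [wealth_eq] at this
        exact this
      · intro h1 s hs
        rw [wealth_eq]
        exact h1 ⟨s, hs⟩
  have hVmeas : ∀ t, MeasurableSet (V t) := by
    intro t
    obtain ⟨S, hS, hSV⟩ := hVm t
    rw [← MeasurableSet.compl_iff, hSV]
    exact h.measurable_history t hS
  -- The invariant is the mean of the wealth frozen at the first crossing, with the frozen value
  -- replaced by its lower bound `x`.
  have key : ∀ t, x * P (V t) + ∫⁻ ω in (V t)ᶜ, M t ω ∂P ≤ 1 := by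
    intro t
    induction t with
    | zero =>
      have h0 : V 0 = ∅ := by ext ω; simp [hV]
      rw [h0]
      simp [hM, wealth]
    | succ t ih =>
      obtain ⟨S, hS, hSV⟩ := hVm t
      have hBm : MeasurableSet {ω | x ≤ M t ω} := measurableSet_le measurable_const (hMm t)
      have hsplit : V (t + 1) = V t ∪ ((V t)ᶜ ∩ {ω | x ≤ M t ω}) := by
        ext ω
        simp only [hV, Set.mem_ofPred_eq, Set.mem_union, Set.mem_inter_iff, Set.mem_compl_iff]
        constructor
        · rintro ⟨s, hs, hx⟩
          by_cases hc : ∃ s < t, x ≤ M s ω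
          · exact Or.inl hc
          · right
            refine ⟨hc, ?_⟩
            rcases Nat.lt_succ_iff_lt_or_eq.1 hs with h' | rfl
            · exact absurd ⟨s, h', hx⟩ hc
            · exact hx
        · rintro (⟨s, hs, hx⟩ | ⟨_, hx⟩)
          · exact ⟨s, hs.trans (Nat.lt_succ_self t), hx⟩
          · exact ⟨t, Nat.lt_succ_self t, hx⟩
      have hsplit' : (V (t + 1))ᶜ = (V t)ᶜ ∩ {ω | x ≤ M t ω}ᶜ := by
        rw [hsplit]
        ext ω
        simp only [Set.mem_compl_iff, Set.mem_union, Set.mem_inter_iff, Set.mem_ofPred_eq]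
        tauto
      -- `V (t + 1)` only involves wealth up to time `t`, so its complement is still an event of the
      -- first `t` rounds.
      obtain ⟨S', hS', hSV'⟩ : ∃ S' : Set (Fin t → Fin K × ℝ), MeasurableSet S' ∧
          (V (t + 1))ᶜ = history A X t ⁻¹' S' := by
        refine ⟨S ∩ {g | x ≤ wealthOf π G t g}ᶜ,
          hS.inter (measurableSet_le measurable_const (measurable_wealthOf hG t)).compl, ?_⟩
        rw [hsplit', hSV]
        ext ω
        simp only [hM, wealth_eq]
        rfl
      have h1 : ∫⁻ ω in (V (t + 1))ᶜ, M (t + 1) ω ∂P ≤ ∫⁻ ω in (V (t + 1))ᶜ, M t ω ∂P := by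
        rw [hSV']
        exact setLIntegral_wealth_succ_le h hG hG1 t hS'
      have h2 : x * P ((V t)ᶜ ∩ {ω | x ≤ M t ω})
          ≤ ∫⁻ ω in (V t)ᶜ ∩ {ω | x ≤ M t ω}, M t ω ∂P := by
        rw [← setLIntegral_const]
        apply setLIntegral_mono (hMm t)
        intro ω hω
        exact hω.2
      have h3 : ∫⁻ ω in (V t)ᶜ ∩ {ω | x ≤ M t ω}, M t ω ∂P + ∫⁻ ω in (V (t + 1))ᶜ, M t ω ∂P
          = ∫⁻ ω in (V t)ᶜ, M t ω ∂P := by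
        rw [hsplit', ← Set.sdiff_eq, lintegral_inter_add_sdiff _ _ hBm]
      calc x * P (V (t + 1)) + ∫⁻ ω in (V (t + 1))ᶜ, M (t + 1) ω ∂P
          ≤ x * (P (V t) + P ((V t)ᶜ ∩ {ω | x ≤ M t ω}))
            + ∫⁻ ω in (V (t + 1))ᶜ, M t ω ∂P := by
            gcongr
            rw [hsplit]
            exact measure_union_le _ _
        _ = x * P (V t) + (x * P ((V t)ᶜ ∩ {ω | x ≤ M t ω})
            + ∫⁻ ω in (V (t + 1))ᶜ, M t ω ∂P) := by rw [mul_add, add_assoc]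
        _ ≤ x * P (V t) + ∫⁻ ω in (V t)ᶜ, M t ω ∂P := by
            rw [← h3]
            gcongr
        _ ≤ 1 := ih
  have hUnion : {ω | ∃ t, x ≤ wealth π G (fun s => A s ω) (fun s => X s ω) t} = ⋃ t, V t := by
    ext ω
    simp only [hV, hM, Set.mem_ofPred_eq, Set.mem_iUnion]
    constructor
    · rintro ⟨t, ht⟩
      exact ⟨t + 1, t, Nat.lt_succ_self t, ht⟩
    · rintro ⟨_, s, _, hs⟩
      exact ⟨s, hs⟩
  have hmono : Monotone V := by
    intro s t hst ω hω
    obtain ⟨r, hr, hx⟩ := hω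
    exact ⟨r, hr.trans_le hst, hx⟩
  rw [hUnion, hmono.measure_iUnion, ENNReal.mul_iSup]
  exact iSup_le fun t => le_self_add.trans (key t)

end Ville

/-! ### Exponential factors of sub-Gaussian arms. -/

/-- The sum of the centered rewards of arm `a` in the first `t` rounds. -/
noncomputable def centeredSum {K : ℕ} (m : Fin K → ℝ) (A : ℕ → Fin K) (X : ℕ → ℝ) (a : Fin K)
    (t : ℕ) : ℝ :=
  ∑ s ∈ (Finset.range t).filter (fun s => A s = a), (X s - m a)

/-- The factor of the exponential supermartingale in the direction `l • w`. -/
noncomputable def expFactor {K : ℕ} (m w : Fin K → ℝ) (l : ℝ) (a : Fin K) (x : ℝ) : ℝ≥0∞ :=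
  ENNReal.ofReal (Real.exp (l * w a * (x - m a) - (l * w a) ^ 2 / 2))

theorem measurable_expFactor {K : ℕ} (m w : Fin K → ℝ) :
    Measurable fun p : ℝ × Fin K × ℝ => expFactor m w p.1 p.2.1 p.2.2 := by
  unfold expFactor
  have hw : Measurable fun p : ℝ × Fin K × ℝ => w p.2.1 :=
    (measurable_of_countable w).comp (measurable_fst.comp measurable_snd)
  have hm : Measurable fun p : ℝ × Fin K × ℝ => m p.2.1 :=
    (measurable_of_countable m).comp (measurable_fst.comp measurable_snd)
  fun_prop

theorem lintegral_expFactor_le {K : ℕ} {ν : Fin K → Measure ℝ} (hν : IsSubGaussianInstance ν)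
    (w : Fin K → ℝ) (l : ℝ) (a : Fin K) : ∫⁻ x, expFactor (mean ν) w l a x ∂ν a ≤ 1 := by
  have hsub := (hν a).2
  unfold expFactor
  have hint := hsub.integrable_exp_mul (l * w a)
  have hle := hsub.mgf_le (l * w a)
  have heq : ∀ x, Real.exp (l * w a * (x - mean ν a) - (l * w a) ^ 2 / 2)
      = Real.exp (l * w a * (x - mean ν a)) * Real.exp (-((l * w a) ^ 2 / 2)) := by
    intro x
    rw [← Real.exp_add]
    congr 1
  simp_rw [heq]
  rw [← ofReal_integral_eq_lintegral_ofReal (hint.mul_const _)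
    (Eventually.of_forall fun x => by positivity), integral_mul_const]
  unfold mgf at hle
  rw [← ENNReal.ofReal_one]
  apply ENNReal.ofReal_le_ofReal
  calc (∫ x, Real.exp (l * w a * (x - mean ν a)) ∂ν a) * Real.exp (-((l * w a) ^ 2 / 2))
      ≤ Real.exp (((1 : ℝ≥0) : ℝ) * (l * w a) ^ 2 / 2) * Real.exp (-((l * w a) ^ 2 / 2)) := by
        gcongr
    _ = 1 := by
        rw [← Real.exp_add]
        simp

theorem prod_expFactor {K : ℕ} (m w : Fin K → ℝ) (l : ℝ) (A : ℕ → Fin K) (X : ℕ → ℝ) (t : ℕ) :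
    ∏ s ∈ Finset.range t, expFactor m w l (A s) (X s)
      = ENNReal.ofReal (Real.exp (∑ a, (l * w a * centeredSum m A X a t
        - (l * w a) ^ 2 * (pulls A a t : ℝ) / 2))) := by
  unfold expFactor
  rw [← ENNReal.ofReal_prod_of_nonneg (fun s _ => (Real.exp_pos _).le), ← Real.exp_sum]
  congr 2
  rw [← Finset.sum_fiberwise (Finset.range t) A]
  apply Finset.sum_congr rfl
  intro a _
  have h1 : ∑ s ∈ (Finset.range t).filter (fun s => A s = a),
      (l * w (A s) * (X s - m (A s)) - (l * w (A s)) ^ 2 / 2)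
      = ∑ s ∈ (Finset.range t).filter (fun s => A s = a),
      (l * w a * (X s - m a) - (l * w a) ^ 2 / 2) := by
    apply Finset.sum_congr rfl
    intro s hs
    rw [(Finset.mem_filter.1 hs).2]
  rw [h1, Finset.sum_sub_distrib, ← Finset.mul_sum, Finset.sum_const, nsmul_eq_mul]
  unfold centeredSum pulls
  ring

/-! ### Deviation inequalities. -/

section Concentration

variable {K : ℕ} {Ω : Type*} [MeasurableSpace Ω] {P : Measure Ω} [IsProbabilityMeasure P] {θ : ℝ}
  {ν : Fin K → Measure ℝ} {A : ℕ → Ω → Fin K} {X : ℕ → Ω → ℝ}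

/-- Ville's inequality with the mixture reduced to a point mass, in an arbitrary direction over the
arms. -/
theorem measure_exists_le_linear_le (h : IsAPGAIRun P θ ν A X) (hν : IsSubGaussianInstance ν)
    (w : Fin K → ℝ) (x : ℝ) :
    P {ω | ∃ t, x ≤ ∑ a, (w a * centeredSum (mean ν) (fun s => A s ω) (fun s => X s ω) a t
        - w a ^ 2 * (pulls (fun s => A s ω) a t : ℝ) / 2)} ≤ ENNReal.ofReal (Real.exp (-x)) := by
  have : ∀ a, IsProbabilityMeasure (ν a) := fun a => (hν a).1
  have hV := measure_exists_le_wealth (π := Measure.dirac (1 : ℝ)) h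
    (measurable_expFactor (mean ν) w) (lintegral_expFactor_le hν w)
    (ENNReal.ofReal (Real.exp x))
  have hset : {ω | ∃ t, x ≤ ∑ a, (w a * centeredSum (mean ν) (fun s => A s ω) (fun s => X s ω) a t
        - w a ^ 2 * (pulls (fun s => A s ω) a t : ℝ) / 2)}
      = {ω | ∃ t, ENNReal.ofReal (Real.exp x) ≤ wealth (Measure.dirac (1 : ℝ))
        (expFactor (mean ν) w) (fun s => A s ω) (fun s => X s ω) t} := by
    ext ω
    apply exists_congr
    intro t
    unfold wealth
    simp_rw [prod_expFactor]
    rw [lintegral_dirac, ENNReal.ofReal_le_ofReal_iff (Real.exp_pos _).le, Real.exp_le_exp]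
    simp only [one_mul]
  rw [hset]
  rw [Real.exp_neg, ENNReal.ofReal_inv_of_pos (Real.exp_pos _)]
  rw [ENNReal.le_inv_iff_mul_le, mul_comm]
  exact hV

/-- A fixed-sample deviation bound for one arm, uniform over the rounds. -/
theorem measure_deviation_le (h : IsAPGAIRun P θ ν A X) (hν : IsSubGaussianInstance ν)
    (a : Fin K) {σ : ℝ} (hσ : σ ^ 2 = 1) {j : ℕ} (hj : 1 ≤ j) {y : ℝ} (hy : 0 ≤ y) :
    P {ω | ∃ t, pulls (fun s => A s ω) a t = j ∧
        √j * √y ≤ σ * centeredSum (mean ν) (fun s => A s ω) (fun s => X s ω) a t}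
      ≤ ENNReal.ofReal (Real.exp (-(y / 2))) := by
  refine le_trans (measure_mono ?_)
    -- The slope that is optimal at exactly `j` pulls: the exponent is then at least `y - y / 2`.
    (measure_exists_le_linear_le h hν (Pi.single a (σ * (√y / √j))) (y / 2))
  rintro ω ⟨t, hN, hdev⟩
  refine ⟨t, ?_⟩
  rw [Finset.sum_eq_single a]
  · rw [Pi.single_eq_same, hN]
    have hj0 : (0 : ℝ) < j := by positivity
    have hsj : 0 < √(j : ℝ) := Real.sqrt_pos.2 hj0
    have h1 : (σ * (√y / √j)) ^ 2 * (j : ℝ) = y := by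
      rw [mul_pow, div_pow, Real.sq_sqrt hy, Real.sq_sqrt hj0.le, hσ]
      field_simp
    have h2 : y ≤ σ * (√y / √j) * centeredSum (mean ν) (fun s => A s ω) (fun s => X s ω) a t := by
      calc y = (√y / √j) * (√j * √y) := by
            field_simp
            rw [Real.sq_sqrt hy]
        _ ≤ (√y / √j) * (σ * centeredSum (mean ν) (fun s => A s ω) (fun s => X s ω) a t) := by
            gcongr
        _ = _ := by ring
    linarith
  · intro b _ hb
    simp [Pi.single_eq_of_ne hb]
  · simp

/-- A fixed-sample deviation bound for a pair of arms, uniform over the rounds. -/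
theorem measure_pair_deviation_le (h : IsAPGAIRun P θ ν A X) (hν : IsSubGaussianInstance ν)
    {a b : Fin K} (hab : a ≠ b) {σ ρ : ℝ} (hσ : σ ^ 2 = 1) (hρ : ρ ^ 2 = 1)
    {j k : ℕ} (hj : 1 ≤ j) (hk : 1 ≤ k) {y : ℝ} (hy : 0 ≤ y) :
    P {ω | ∃ t, pulls (fun s => A s ω) a t = j ∧ pulls (fun s => A s ω) b t = k ∧
        y ≤ σ * centeredSum (mean ν) (fun s => A s ω) (fun s => X s ω) a t / √j
          + ρ * centeredSum (mean ν) (fun s => A s ω) (fun s => X s ω) b t / √k}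
      ≤ ENNReal.ofReal (Real.exp (-(y ^ 2 / 4))) := by
  refine le_trans (measure_mono ?_) (measure_exists_le_linear_le h hν
    -- The two normalised sums have total variance proxy `2`, so the optimal slope is `y / 2`, and
    -- the exponent is `y² / 2 - y² / 4`.
    (fun c => if c = a then y / 2 * σ / √j else if c = b then y / 2 * ρ / √k else 0) (y ^ 2 / 4))
  rintro ω ⟨t, hNa, hNb, hdev⟩
  refine ⟨t, ?_⟩
  rw [← Finset.sum_subset (Finset.subset_univ {a, b}), Finset.sum_pair hab]
  · simp only [if_true, hab.symm, if_false, hNa, hNb]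
    have hj0 : (0 : ℝ) < j := by positivity
    have hk0 : (0 : ℝ) < k := by positivity
    have h1 : (y / 2 * σ / √j) ^ 2 * (j : ℝ) = y ^ 2 / 4 := by
      rw [div_pow, mul_pow, Real.sq_sqrt hj0.le, hσ]
      field_simp
      norm_num
    have h2 : (y / 2 * ρ / √k) ^ 2 * (k : ℝ) = y ^ 2 / 4 := by
      rw [div_pow, mul_pow, Real.sq_sqrt hk0.le, hρ]
      field_simp
      norm_num
    have h3 := mul_le_mul_of_nonneg_left hdev (show 0 ≤ y / 2 by linarith)
    rw [h1, h2]
    calc y ^ 2 / 4 = y / 2 * y - y ^ 2 / 4 / 2 - y ^ 2 / 4 / 2 := by ring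
      _ ≤ _ := by
        refine le_trans (sub_le_sub_right (sub_le_sub_right h3 _) _) (le_of_eq ?_)
        ring
  · intro c _ hc
    have hca : c ≠ a := by rintro rfl; simp at hc
    have hcb : c ≠ b := by rintro rfl; simp at hc
    simp [hca, hcb]

/-! ### Time-uniform deviations by the method of mixtures -/

/-- Completing the square: the integrand times the prior density is a constant times the Gaussian
density of variance `v' = v / (1 + vN)` and mean `v' S`. -/
theorem lintegral_exp_gaussianReal (S N : ℝ) (hN : 0 ≤ N) {v : ℝ≥0} (hv : v ≠ 0) :
    ∫⁻ l, ENNReal.ofReal (Real.exp (l * S - l ^ 2 * N / 2)) ∂gaussianReal 0 v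
      = ENNReal.ofReal (Real.exp (v * S ^ 2 / (2 * (1 + v * N))) / √(1 + v * N)) := by
  have hv0 : (0 : ℝ) < v := by positivity
  have hpos : (0 : ℝ) < 1 + v * N := by positivity
  set v' : ℝ≥0 := v / (1 + v * N.toNNReal) with hv'
  have hcoe : (v' : ℝ) = v / (1 + v * N) := by
    rw [hv']; push_cast; rw [Real.coe_toNNReal _ hN]
  have hv'0 : v' ≠ 0 := by
    rw [← NNReal.coe_ne_zero, hcoe]
    positivity
  rw [gaussianReal_of_var_ne_zero _ hv,
    lintegral_withDensity_eq_lintegral_mul _ (measurable_gaussianPDF 0 v) (by fun_prop)]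
  have hpt : ∀ l, (gaussianPDF 0 v * fun l => ENNReal.ofReal (Real.exp (l * S - l ^ 2 * N / 2))) l
      = ENNReal.ofReal (Real.exp (v * S ^ 2 / (2 * (1 + v * N))) / √(1 + v * N))
        * gaussianPDF (v' * S) v' l := by
    intro l
    rw [Pi.mul_apply, gaussianPDF, gaussianPDF, ← ENNReal.ofReal_mul (gaussianPDFReal_nonneg _ _ _),
      ← ENNReal.ofReal_mul (by positivity)]
    congr 1
    rw [gaussianPDFReal, gaussianPDFReal, hcoe]
    have hsq : √(2 * Real.pi * (v / (1 + v * N))) = √(2 * Real.pi * v) / √(1 + v * N) := by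
      rw [← mul_div_assoc, Real.sqrt_div (by positivity)]
    rw [hsq]
    have hs1 : 0 < √(2 * Real.pi * v) := Real.sqrt_pos.2 (by positivity)
    have hs2 : 0 < √(1 + v * N) := Real.sqrt_pos.2 hpos
    have hexp : Real.exp (-(l - 0) ^ 2 / (2 * v)) * Real.exp (l * S - l ^ 2 * N / 2)
        = Real.exp (v * S ^ 2 / (2 * (1 + v * N)))
          * Real.exp (-(l - v / (1 + v * N) * S) ^ 2 / (2 * (v / (1 + v * N)))) := by
      rw [← Real.exp_add, ← Real.exp_add]
      congr 1
      field_simp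
      ring
    rw [mul_assoc, hexp]
    field_simp
  simp_rw [hpt]
  rw [lintegral_const_mul _ (measurable_gaussianPDF _ _), lintegral_gaussianPDF_eq_one _ hv'0,
    mul_one]

/-- On this interval the maximum is at `e^{-4}`, with value `4 + e^{-4}`. It bounds the loss from
using one prior variance on a slice of ratio `e^4`. -/
theorem sub_log_le_of_mem_Icc {r : ℝ} (h1 : Real.exp (-4) ≤ r) (h2 : r ≤ 1) :
    r - Real.log r ≤ 9 / 2 := by
  have hq := Real.exp_pos (-4)
  have hr : 0 < r := hq.trans_le h1
  have h3 := Real.one_sub_inv_le_log_of_pos (show 0 < r / Real.exp (-4) by positivity)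
  rw [Real.log_div hr.ne' hq.ne', Real.log_exp, inv_div] at h3
  have h4 : r - Real.exp (-4) ≤ 1 - Real.exp (-4) / r := by
    rw [one_sub_div hr.ne', le_div_iff₀ hr]
    nlinarith
  have h5 : Real.exp (-4) ≤ 1 / 2 := by
    rw [Real.exp_neg, inv_eq_one_div]
    apply one_div_le_one_div_of_le two_pos
    linarith [Real.add_one_le_exp 4]
  linarith

/-- Deviations on a geometric slice of sample sizes. -/
theorem measure_slice_deviation_le (h : IsAPGAIRun P θ ν A X) (hν : IsSubGaussianInstance ν)
    (a : Fin K) {y L : ℝ} (hy : 1 < y) (hL : 1 ≤ L) :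
    P {ω | ∃ t, L ≤ pulls (fun s => A s ω) a t ∧
        (pulls (fun s => A s ω) a t : ℝ) ≤ Real.exp 4 * L ∧
        pulls (fun s => A s ω) a t * y
          ≤ centeredSum (mean ν) (fun s => A s ω) (fun s => X s ω) a t ^ 2}
      ≤ ENNReal.ofReal (Real.exp (-((y - Real.log y - 9 / 2) / 2))) := by
  have : ∀ a, IsProbabilityMeasure (ν a) := fun a => (hν a).1
  -- The variance optimal at the left end `N = L` of the slice. On the slice `1 + vN` lies between
  -- `y` and `e^4 y`, so `r = y / (1 + u)` falls in `[e^{-4}, 1]`.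
  set v : ℝ≥0 := ((y - 1) / L).toNNReal with hv
  have hv0 : 0 < (y - 1) / L := div_pos (by linarith) (by linarith)
  have hvc : (v : ℝ) = (y - 1) / L := Real.coe_toNNReal _ hv0.le
  have hvne : v ≠ 0 := by
    rw [← NNReal.coe_ne_zero, hvc]; exact hv0.ne'
  set x : ℝ := (y - Real.log y - 9 / 2) / 2 with hx
  have hV := measure_exists_le_wealth (π := gaussianReal 0 v) h
    (measurable_expFactor (mean ν) (Pi.single a 1)) (lintegral_expFactor_le hν (Pi.single a 1))
    (ENNReal.ofReal (Real.exp x))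
  rw [Real.exp_neg, ENNReal.ofReal_inv_of_pos (Real.exp_pos _), ENNReal.le_inv_iff_mul_le, mul_comm]
  refine le_trans ?_ hV
  gcongr with ω t
  rintro ⟨hN1, hN2, hdev⟩
  unfold wealth
  simp_rw [prod_expFactor]
  set N : ℝ := (pulls (fun s => A s ω) a t : ℝ) with hN
  set S : ℝ := centeredSum (mean ν) (fun s => A s ω) (fun s => X s ω) a t with hS
  have hsum : ∀ l : ℝ, ∑ b, (l * (Pi.single a 1 : Fin K → ℝ) b
        * centeredSum (mean ν) (fun s => A s ω) (fun s => X s ω) b t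
        - (l * (Pi.single a 1 : Fin K → ℝ) b) ^ 2 * (pulls (fun s => A s ω) b t : ℝ) / 2)
      = l * S - l ^ 2 * N / 2 := by
    intro l
    rw [Finset.sum_eq_single a]
    · rw [Pi.single_eq_same, mul_one]
    · intro b _ hb
      simp [Pi.single_eq_of_ne hb]
    · simp
  simp_rw [hsum]
  have hN0 : 0 < N := by linarith
  rw [lintegral_exp_gaussianReal S N hN0.le hvne, hvc]
  apply ENNReal.ofReal_le_ofReal
  set u : ℝ := (y - 1) / L * N with hu
  have hu1 : y - 1 ≤ u := by
    rw [hu, div_mul_eq_mul_div, le_div_iff₀ (by linarith)]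
    gcongr
  have hu2 : u ≤ Real.exp 4 * (y - 1) := by
    rw [hu, div_mul_eq_mul_div, div_le_iff₀ (by linarith)]
    calc (y - 1) * N ≤ (y - 1) * (Real.exp 4 * L) := by
          gcongr
      _ = _ := by ring
  have hu0 : 0 < 1 + u := by linarith
  have hr1 : y / (1 + u) ≤ 1 := by
    rw [div_le_one hu0]; linarith
  have hr2 : Real.exp (-4) ≤ y / (1 + u) := by
    rw [le_div_iff₀ hu0, Real.exp_neg, inv_mul_le_iff₀ (Real.exp_pos 4)]
    nlinarith [Real.add_one_le_exp (4 : ℝ)]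
  have hr := sub_log_le_of_mem_Icc hr2 hr1
  rw [Real.log_div (by linarith) hu0.ne'] at hr
  have hsq : √(1 + u) = Real.exp (Real.log (1 + u) / 2) := by
    rw [Real.exp_half, Real.exp_log hu0]
  rw [hsq, ← Real.exp_sub, Real.exp_le_exp, hx]
  have h1 : u * y / (2 * (1 + u)) ≤ (y - 1) / L * S ^ 2 / (2 * (1 + u)) := by
    apply div_le_div_of_nonneg_right _ (by linarith)
    calc u * y = (y - 1) / L * (N * y) := by rw [hu]; ring
      _ ≤ (y - 1) / L * S ^ 2 := by gcongr
  -- Subtracting `log (1 + u) / 2` leaves `(y - log y - (r - log r)) / 2`, and `r - log r ≤ 9/2`.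
  have h2 : u * y / (2 * (1 + u)) = (y - y / (1 + u)) / 2 := by
    field_simp
    ring
  linarith

theorem pulls_le (A : ℕ → Fin K) (a : Fin K) (t : ℕ) : pulls A a t ≤ t := by
  unfold pulls
  exact (Finset.card_filter_le _ _).trans (by simp)

/-- The deviations of one arm exceed the threshold at some time with probability at most
`δ / K`. -/
theorem measure_threshold_deviation_le (hK : 1 ≤ K) (h : IsAPGAIRun P θ ν A X)
    (hν : IsSubGaussianInstance ν) (a : Fin K) {δ : ℝ} (hδ : δ ∈ Set.Ioo (0 : ℝ) 1) :
    P {ω | ∃ t, 1 ≤ pulls (fun s => A s ω) a t ∧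
        pulls (fun s => A s ω) a t * (2 * threshold K t δ)
          ≤ centeredSum (mean ν) (fun s => A s ω) (fun s => X s ω) a t ^ 2}
      ≤ ENNReal.ofReal (δ / K) := by
  have hK0 : (0 : ℝ) < K := by positivity
  -- Slice `i` consists of `e^{4i} ≤ N ≤ e^{4(i+1)}`. There `4 (i + 1) ≤ 4 + log N`, so `x i` is at
  -- most the argument of `Wbar` in the threshold.
  set x : ℕ → ℝ := fun i => 2 * Real.log (K / δ) + 4 * Real.log (4 * (i + 1)) + 1 / 2 with hx
  have hx6 : ∀ i, 6 ≤ x i := by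
    intro i
    have : Real.log 4 ≤ Real.log (4 * (i + 1)) :=
      Real.log_le_log (by norm_num) (by linarith [(Nat.cast_nonneg i : (0 : ℝ) ≤ i)])
    simp only [hx]
    linarith [log_div_nonneg hK hδ, one_lt_log_four]
  have hval : ∀ i : ℕ, Real.exp (-((x i - 9 / 2) / 2))
      = δ / K * (Real.exp 2 / 16) * (1 / ((i + 1 : ℕ) : ℝ) ^ 2) := by
    intro i
    have hi : (0 : ℝ) < i + 1 := by positivity
    have e1 : -((x i - 9 / 2) / 2)
        = -Real.log (K / δ) + 2 + -Real.log ((4 * ((i : ℝ) + 1)) ^ 2) := by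
      simp only [hx]
      rw [Real.log_pow]
      push_cast
      ring
    rw [e1, Real.exp_add, Real.exp_add, Real.exp_neg, Real.exp_neg,
      Real.exp_log (div_pos hK0 hδ.1), Real.exp_log (by positivity)]
    push_cast
    field_simp
    norm_num
  have hsub : {ω | ∃ t, 1 ≤ pulls (fun s => A s ω) a t ∧
        pulls (fun s => A s ω) a t * (2 * threshold K t δ)
          ≤ centeredSum (mean ν) (fun s => A s ω) (fun s => X s ω) a t ^ 2}
      ⊆ ⋃ i : ℕ, {ω | ∃ t, Real.exp (4 * i) ≤ pulls (fun s => A s ω) a t ∧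
        (pulls (fun s => A s ω) a t : ℝ) ≤ Real.exp 4 * Real.exp (4 * i) ∧
        pulls (fun s => A s ω) a t * Wbar (x i)
          ≤ centeredSum (mean ν) (fun s => A s ω) (fun s => X s ω) a t ^ 2} := by
    rintro ω ⟨t, hN1, hdev⟩
    rw [Set.mem_iUnion]
    set N := pulls (fun s => A s ω) a t with hN
    have hNt : N ≤ t := pulls_le _ _ _
    have hN0 : (0 : ℝ) < N := by exact_mod_cast hN1
    have hlog0 : 0 ≤ Real.log N := log_nat_nonneg N
    refine ⟨⌊Real.log N / 4⌋₊, t, ?_, ?_, ?_⟩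
    · rw [← hN, ← Real.le_log_iff_exp_le hN0]
      linarith [Nat.floor_le (show 0 ≤ Real.log N / 4 by positivity)]
    · rw [← hN, ← Real.exp_add, ← Real.log_le_iff_le_exp hN0]
      linarith [Nat.lt_floor_add_one (Real.log N / 4)]
    · refine le_trans ?_ hdev
      rw [two_mul_threshold (hN1.trans hNt)]
      gcongr
      apply Wbar_mono (by linarith [hx6 ⌊Real.log N / 4⌋₊])
      simp only [hx, thresholdArg]
      gcongr
      have h1 := Nat.floor_le (show 0 ≤ Real.log N / 4 by positivity)
      have h2 : Real.log N ≤ Real.log t := Real.log_le_log hN0 (by exact_mod_cast hNt)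
      linarith
  have hbound : ∀ i : ℕ, P {ω | ∃ t, Real.exp (4 * i) ≤ pulls (fun s => A s ω) a t ∧
        (pulls (fun s => A s ω) a t : ℝ) ≤ Real.exp 4 * Real.exp (4 * i) ∧
        pulls (fun s => A s ω) a t * Wbar (x i)
          ≤ centeredSum (mean ν) (fun s => A s ω) (fun s => X s ω) a t ^ 2}
      ≤ ENNReal.ofReal (δ / K * (Real.exp 2 / 16) * (1 / ((i + 1 : ℕ) : ℝ) ^ 2)) := by
    intro i
    have hx1 : 1 ≤ x i := by linarith [hx6 i]
    have h1 := measure_slice_deviation_le h hν a (y := Wbar (x i)) (L := Real.exp (4 * i))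
      (by linarith [le_Wbar hx1, hx6 i]) (Real.one_le_exp (by positivity))
    rwa [(Wbar_spec hx1).2, hval] at h1
  have hs : HasSum (fun i : ℕ => δ / K * (Real.exp 2 / 16) * (1 / ((i + 1 : ℕ) : ℝ) ^ 2))
      (δ / K * (Real.exp 2 / 16) * (Real.pi ^ 2 / 6)) := by
    apply HasSum.mul_left
    have := (hasSum_nat_add_iff' (f := fun n : ℕ => 1 / (n : ℝ) ^ 2) 1).2 hasSum_zeta_two
    simpa using this
  have hpos : ∀ i : ℕ, 0 ≤ δ / K * (Real.exp 2 / 16) * (1 / ((i + 1 : ℕ) : ℝ) ^ 2) := by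
    intro i
    have := hδ.1
    positivity
  calc _ ≤ P (⋃ i : ℕ, _) := measure_mono hsub
    _ ≤ ∑' i : ℕ, _ := measure_iUnion_le _
    _ ≤ ∑' i : ℕ, ENNReal.ofReal (δ / K * (Real.exp 2 / 16) * (1 / ((i + 1 : ℕ) : ℝ) ^ 2)) :=
        ENNReal.tsum_le_tsum hbound
    _ = ENNReal.ofReal (δ / K * (Real.exp 2 / 16) * (Real.pi ^ 2 / 6)) := by
        rw [← ENNReal.ofReal_tsum_of_nonneg hpos hs.summable, hs.tsum_eq]
    _ ≤ ENNReal.ofReal (δ / K) := by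
        apply ENNReal.ofReal_le_ofReal
        have hdk : 0 ≤ δ / K := div_nonneg hδ.1.le hK0.le
        have he : Real.exp 2 ≤ 7.4 := by
          have h1 := Real.exp_one_lt_d9
          have h2 := Real.exp_pos 1
          have h3 : Real.exp 2 = Real.exp 1 * Real.exp 1 := by
            rw [← Real.exp_add]; norm_num
          rw [h3]
          nlinarith
        have hpi : Real.pi ^ 2 ≤ 10 := by nlinarith [Real.pi_lt_d2, Real.pi_pos]
        -- `e²` is the slice loss `9/2` net of the `1/2` in the threshold, `16 = 4²` comes from `4
        -- (i + 1)`, and `π²/6` from the sum over slices.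
        have : Real.exp 2 / 16 * (Real.pi ^ 2 / 6) ≤ 1 := by
          calc Real.exp 2 / 16 * (Real.pi ^ 2 / 6) ≤ 7.4 / 16 * (10 / 6) := by gcongr
            _ ≤ 1 := by norm_num
        rw [mul_assoc]
        exact mul_le_of_le_one_right hdk this

end Concentration

/-! ### Deterministic analysis of one trajectory. -/

section Trajectory

variable {K : ℕ} {θ δ : ℝ} {m : Fin K → ℝ} {A : ℕ → Fin K} {X : ℕ → ℝ}

/-! ### Numbers of pulls -/

theorem pulls_succ (A : ℕ → Fin K) (a : Fin K) (t : ℕ) :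
    pulls A a (t + 1) = pulls A a t + if A t = a then 1 else 0 := by
  unfold pulls
  rw [Finset.range_add_one, Finset.filter_insert]
  split_ifs with h
  · rw [Finset.card_insert_of_notMem (by simp)]
  · simp

theorem pulls_mono (A : ℕ → Fin K) (a : Fin K) : Monotone (pulls A a) := by
  apply monotone_nat_of_le_succ
  intro t
  rw [pulls_succ]
  exact Nat.le_add_right _ _

theorem sum_pulls (A : ℕ → Fin K) (t : ℕ) : ∑ a, pulls A a t = t := by
  unfold pulls
  rw [← Finset.card_eq_sum_card_fiberwise (fun s _ => Finset.mem_coe.2 (Finset.mem_univ (A s)))]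
  simp

theorem FollowsAPGAI.one_le_pulls (h : FollowsAPGAI θ A X) (a : Fin K) {t : ℕ} (ht : K ≤ t) :
    1 ≤ pulls A a t :=
  (h.1 a).symm.le.trans (pulls_mono A a ht)

/-- Every value of the pull count below the current one was left at an adaptive round. -/
theorem FollowsAPGAI.exists_round (h : FollowsAPGAI θ A X) {a : Fin K} {k n : ℕ} (hk : 1 ≤ k)
    (hkn : k < pulls A a n) : ∃ s, K ≤ s ∧ s < n ∧ A s = a ∧ pulls A a s = k := by
  have hex : ∃ s, k < pulls A a s := ⟨n, hkn⟩
  classical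
  obtain ⟨s, hs⟩ : ∃ s, Nat.find hex = s + 1 := by
    apply Nat.exists_eq_succ_of_ne_zero
    intro h0
    have := Nat.find_spec hex
    rw [h0] at this
    simp [pulls] at this
  have h1 := Nat.find_spec hex
  have h2 : ¬ k < pulls A a s := Nat.find_min hex (by omega)
  have h3 : Nat.find hex ≤ n := Nat.find_min' hex hkn
  rw [hs] at h1 h3
  rw [pulls_succ] at h1
  have hA : A s = a := by
    by_contra hc
    rw [if_neg hc] at h1
    omega
  rw [if_pos hA] at h1
  refine ⟨s, ?_, by omega, hA, by omega⟩
  by_contra! hc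
  have h4 := pulls_mono A a (show s + 1 ≤ K by omega)
  rw [h.1 a, pulls_succ, if_pos hA] at h4
  omega

/-! ### Signed indices -/

/-- The signed index of an arm: `W⁺` minus `W⁻`. -/
noncomputable def signedIndex (θ : ℝ) (A : ℕ → Fin K) (X : ℕ → ℝ) (a : Fin K) (t : ℕ) : ℝ :=
  √(pulls A a t : ℝ) * (empMean A X a t - θ)

theorem signedIndex_le_Wplus (a : Fin K) (t : ℕ) : signedIndex θ A X a t ≤ Wplus θ A X a t :=
  mul_le_mul_of_nonneg_left (le_max_left _ _) (Real.sqrt_nonneg _)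

theorem neg_signedIndex_le_Wminus (a : Fin K) (t : ℕ) :
    -signedIndex θ A X a t ≤ Wminus θ A X a t := by
  unfold signedIndex Wminus
  rw [← mul_neg]
  exact mul_le_mul_of_nonneg_left (le_max_left _ _) (Real.sqrt_nonneg _)

theorem Wplus_eq_of_pos {a : Fin K} {t : ℕ} (h : 0 < Wplus θ A X a t) :
    θ < empMean A X a t ∧ Wplus θ A X a t = signedIndex θ A X a t := by
  have hlt : θ < empMean A X a t := by
    by_contra! hc
    unfold Wplus at h
    rw [max_eq_right (by linarith), mul_zero] at h
    exact lt_irrefl _ h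
  refine ⟨hlt, ?_⟩
  unfold Wplus signedIndex
  rw [max_eq_left (by linarith)]

theorem Wminus_eq_of_pos {a : Fin K} {t : ℕ} (h : 0 < Wminus θ A X a t) :
    empMean A X a t < θ ∧ Wminus θ A X a t = -signedIndex θ A X a t := by
  have hlt : empMean A X a t < θ := by
    by_contra! hc
    unfold Wminus at h
    rw [max_eq_right (by linarith), mul_zero] at h
    exact lt_irrefl _ h
  refine ⟨hlt, ?_⟩
  unfold Wminus signedIndex
  rw [max_eq_left (by linarith)]
  ring

theorem FollowsAPGAI.sqrt_pulls_pos (h : FollowsAPGAI θ A X) (a : Fin K) {t : ℕ} (ht : K ≤ t) :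
    0 < √(pulls A a t : ℝ) :=
  Real.sqrt_pos.2 (by exact_mod_cast h.one_le_pulls a ht)

/-- The sampling rule pulls an arm of largest signed index. -/
theorem FollowsAPGAI.signedIndex_le (h : FollowsAPGAI θ A X) {t : ℕ} (ht : K ≤ t) (b : Fin K) :
    signedIndex θ A X b t ≤ signedIndex θ A X (A t) t := by
  by_cases hc : ∃ c, θ < empMean A X c t
  · obtain ⟨c, hcθ⟩ := hc
    have h1 := (h.2 t ht).2 ⟨c, hcθ⟩
    have h2 : 0 < Wplus θ A X c t := by
      unfold Wplus
      rw [max_eq_left (by linarith)]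
      exact mul_pos (h.sqrt_pulls_pos c ht) (by linarith)
    rw [← (Wplus_eq_of_pos (h2.trans_le (h1 c))).2]
    exact (signedIndex_le_Wplus b t).trans (h1 b)
  · push Not at hc
    have h1 := (h.2 t ht).1 hc b
    have h2 : ∀ c, Wminus θ A X c t = -signedIndex θ A X c t := by
      intro c
      unfold Wminus signedIndex
      rw [max_eq_left (by linarith [hc c])]
      ring
    rw [h2, h2] at h1
    linarith

/-! ### Deviations in the direction of the wrong decision -/

/-- The direction in which the empirical mean of an arm misleads: downwards for a good arm,
upwards for the others. -/
noncomputable def armSign (θ : ℝ) (m : Fin K → ℝ) (a : Fin K) : ℝ :=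
  open scoped Classical in if θ ≤ m a then -1 else 1

theorem armSign_of_mem {a : Fin K} (h : a ∈ goodArms θ m) : armSign θ m a = -1 := by
  unfold armSign
  rw [if_pos (Finset.mem_filter.1 h).2]

theorem armSign_of_notMem {a : Fin K} (h : a ∉ goodArms θ m) : armSign θ m a = 1 := by
  unfold armSign
  rw [if_neg]
  intro hc
  exact h (Finset.mem_filter.2 ⟨Finset.mem_univ a, hc⟩)

theorem armSign_sq (a : Fin K) : armSign θ m a ^ 2 = 1 := by
  unfold armSign
  split_ifs <;> norm_num

theorem armSign_mul_sub (a : Fin K) : armSign θ m a * (m a - θ) = -gap θ m a := by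
  unfold armSign gap
  split_ifs with h
  · rw [abs_of_nonneg (by linarith)]; ring
  · rw [abs_of_neg (by linarith)]; ring

theorem centeredSum_eq {a : Fin K} {t : ℕ} (hN : 1 ≤ pulls A a t) :
    centeredSum m A X a t = pulls A a t * (empMean A X a t - m a) := by
  have hN0 : (pulls A a t : ℝ) ≠ 0 := by positivity
  have h1 : (pulls A a t : ℝ) * empMean A X a t
      = ∑ s ∈ (Finset.range t).filter (fun s => A s = a), X s := by
    unfold empMean
    field_simp
  rw [mul_sub, h1]
  unfold centeredSum pulls
  rw [Finset.sum_sub_distrib, Finset.sum_const, nsmul_eq_mul]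

/-- The normalised deviation of an arm, in the direction that misleads. -/
noncomputable def deviation (θ : ℝ) (m : Fin K → ℝ) (A : ℕ → Fin K) (X : ℕ → ℝ) (a : Fin K)
    (t : ℕ) : ℝ :=
  armSign θ m a * centeredSum m A X a t / √(pulls A a t : ℝ)

theorem armSign_mul_signedIndex {a : Fin K} {t : ℕ} (hN : 1 ≤ pulls A a t) :
    armSign θ m a * signedIndex θ A X a t
      = deviation θ m A X a t - √(pulls A a t : ℝ) * gap θ m a := by
  have hs : √(pulls A a t : ℝ) ≠ 0 := (Real.sqrt_pos.2 (by exact_mod_cast hN)).ne'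
  have hdev : deviation θ m A X a t
      = armSign θ m a * (√(pulls A a t : ℝ) * (empMean A X a t - m a)) := by
    unfold deviation
    rw [centeredSum_eq hN]
    rw [div_eq_iff hs]
    have := Real.mul_self_sqrt (show (0 : ℝ) ≤ pulls A a t by positivity)
    linear_combination (-armSign θ m a * (empMean A X a t - m a)) * this
  rw [hdev]
  unfold signedIndex
  linear_combination (√(pulls A a t : ℝ)) * armSign_mul_sub (θ := θ) (m := m) a

theorem signedIndex_of_mem {a : Fin K} {t : ℕ} (hN : 1 ≤ pulls A a t) (h : a ∈ goodArms θ m) :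
    signedIndex θ A X a t = √(pulls A a t : ℝ) * gap θ m a - deviation θ m A X a t := by
  have := armSign_mul_signedIndex (θ := θ) (m := m) (X := X) hN
  rw [armSign_of_mem h] at this
  linarith

theorem signedIndex_of_notMem {a : Fin K} {t : ℕ} (hN : 1 ≤ pulls A a t) (h : a ∉ goodArms θ m) :
    signedIndex θ A X a t = deviation θ m A X a t - √(pulls A a t : ℝ) * gap θ m a := by
  have := armSign_mul_signedIndex (θ := θ) (m := m) (X := X) hN
  rw [armSign_of_notMem h] at this
  linarith

/-- Pulling an arm below the threshold requires a joint deviation of that arm and of any good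
arm. -/
theorem FollowsAPGAI.le_deviation_add (h : FollowsAPGAI θ A X) {t : ℕ} (ht : K ≤ t) {a : Fin K}
    (ha : a ∈ goodArms θ m) (hb : A t ∉ goodArms θ m) :
    √(pulls A a t : ℝ) * gap θ m a + √(pulls A (A t) t : ℝ) * gap θ m (A t)
      ≤ deviation θ m A X a t + deviation θ m A X (A t) t := by
  have h1 := h.signedIndex_le ht a
  rw [signedIndex_of_mem (h.one_le_pulls a ht) ha,
    signedIndex_of_notMem (h.one_le_pulls (A t) ht) hb] at h1
  linarith

/-! ### Stopping -/

theorem iInf_natCast_eq {s : Set ℕ} (hs : s.Nonempty) :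
    (⨅ t ∈ s, (t : ℕ∞)) = ((sInf s : ℕ) : ℕ∞) :=
  le_antisymm (iInf₂_le _ (Nat.sInf_mem hs))
    (le_iInf₂ fun t ht => by exact_mod_cast Nat.sInf_le ht)

theorem toNat_iInf_mem {s : Set ℕ} (h : (⨅ t ∈ s, (t : ℕ∞)) ≠ ⊤) :
    (⨅ t ∈ s, (t : ℕ∞)).toNat ∈ s := by
  have hs : s.Nonempty := by
    by_contra hc
    rw [Set.not_nonempty_iff_eq_empty] at hc
    simp [hc] at h
  rw [iInf_natCast_eq hs, ENat.toNat_natCast]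
  exact Nat.sInf_mem hs

theorem tau_toNat_spec (h : tau θ δ A X ≠ ⊤) :
    K ≤ (tau θ δ A X).toNat ∧
      ((∃ a, √(2 * threshold K (tau θ δ A X).toNat δ) ≤ Wplus θ A X a (tau θ δ A X).toNat) ∨
        (∀ a, √(2 * threshold K (tau θ δ A X).toNat δ)
          ≤ Wminus θ A X a (tau θ δ A X).toNat)) := by
  rcases min_choice (tauPlus θ δ A X) (tauMinus θ δ A X) with hm | hm
  · have he : tau θ δ A X = tauPlus θ δ A X := hm
    rw [he] at h ⊢
    have := toNat_iInf_mem h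
    exact ⟨this.1, Or.inl this.2⟩
  · have he : tau θ δ A X = tauMinus θ δ A X := hm
    rw [he] at h ⊢
    have := toNat_iInf_mem h
    exact ⟨this.1, Or.inr this.2⟩

theorem not_stopped_of_lt_tau {n s : ℕ} (hn : (n : ℕ∞) < tau θ δ A X) (hK : K ≤ s) (hs : s ≤ n) :
    (∀ a, Wplus θ A X a s < √(2 * threshold K s δ)) ∧
      ∃ a, Wminus θ A X a s < √(2 * threshold K s δ) := by
  obtain ⟨h1, h2⟩ := lt_min_iff.1 hn
  have hsn : (s : ℕ∞) ≤ n := by exact_mod_cast hs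
  constructor
  · by_contra! hc
    have : tauPlus θ δ A X ≤ s := iInf₂_le s ⟨hK, hc⟩
    exact absurd (this.trans hsn) (not_le.2 h1)
  · by_contra! hc
    have : tauMinus θ δ A X ≤ s := iInf₂_le s ⟨hK, hc⟩
    exact absurd (this.trans hsn) (not_le.2 h2)

/-- A relevant arm pulled before stopping has not been pulled much, up to its deviation. -/
theorem FollowsAPGAI.sqrt_pulls_mul_gap_lt (h : FollowsAPGAI θ A X) {n s : ℕ}
    (hn : (n : ℕ∞) < tau θ δ A X) (hK : K ≤ s) (hs : s ≤ n) (ha : A s ∈ relevantArms θ m) :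
    √(pulls A (A s) s : ℝ) * gap θ m (A s)
      < √(2 * threshold K s δ) + deviation θ m A X (A s) s := by
  obtain ⟨h1, b, h2⟩ := not_stopped_of_lt_tau hn hK hs
  have hN := h.one_le_pulls (A s) hK
  -- Without good arms, some `b` has `W⁻` below the threshold, and the pulled arm has an index at
  -- least that of `b`. With good arms, `W⁺` of the pulled arm itself is below the threshold.
  rcases (goodArms θ m).eq_empty_or_nonempty with hg | hg
  · have h3 := signedIndex_of_notMem (θ := θ) (m := m) (X := X) hN
      (by rw [hg]; exact Finset.notMem_empty _)
    have h4 := h.signedIndex_le hK b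
    have h5 := neg_signedIndex_le_Wminus (θ := θ) (A := A) (X := X) b s
    linarith
  · rw [relevantArms_of_nonempty hg] at ha
    have h3 := signedIndex_of_mem (X := X) hN ha
    have h4 := signedIndex_le_Wplus (θ := θ) (A := A) (X := X) (A s) s
    linarith [h1 (A s)]

/-- The number of pulls of a relevant arm before stopping, when its deviations are small. -/
theorem FollowsAPGAI.pulls_le_of_lt_tau (hK : 1 ≤ K) (hδ : δ ∈ Set.Ioo (0 : ℝ) 1)
    (h : FollowsAPGAI θ A X) (hm : ∀ a, m a ≠ θ) {n : ℕ} (hn : (n : ℕ∞) < tau θ δ A X)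
    {a : Fin K} (ha : a ∈ relevantArms θ m)
    (hdev : ∀ s, K ≤ s → s ≤ n → deviation θ m A X a s ≤ √(6 * Real.log n)) :
    (pulls A a n : ℝ) ≤ 1 + 2 * radiusSq K n δ * ((gap θ m a) ^ 2)⁻¹ := by
  have hgap := gap_pos hm a
  have hq := radiusSq_nonneg K n δ
  by_cases hN : 2 ≤ pulls A a n
  · obtain ⟨s, hKs, hsn, hAs, hNs⟩ := h.exists_round (a := a) (k := pulls A a n - 1) (n := n)
      (by omega) (by omega)
    have h1 := h.sqrt_pulls_mul_gap_lt hn hKs hsn.le (m := m) (by rw [hAs]; exact ha)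
    rw [hAs, hNs] at h1
    have h2 := hdev s hKs hsn.le
    have h3 : √(2 * threshold K s δ) ≤ √(2 * threshold K n δ) := by
      apply Real.sqrt_le_sqrt
      linarith [threshold_mono hK hδ (hK.trans hKs) hsn.le]
    have h4 : √(2 * threshold K n δ) + √(6 * Real.log n)
        = √2 * (√(threshold K n δ) + √(3 * Real.log n)) := by
      rw [Real.sqrt_mul zero_le_two, show 6 * Real.log n = 2 * (3 * Real.log n) by ring,
        Real.sqrt_mul zero_le_two]
      ring
    have h5 : √((pulls A a n - 1 : ℕ) : ℝ) * gap θ m a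
        ≤ √2 * (√(threshold K n δ) + √(3 * Real.log n)) := by
      rw [← h4]; linarith
    have h6 := pow_le_pow_left₀ (by positivity) h5 2
    rw [mul_pow, mul_pow, Real.sq_sqrt (Nat.cast_nonneg _), Real.sq_sqrt zero_le_two] at h6
    have h7 : ((pulls A a n - 1 : ℕ) : ℝ) ≤ 2 * radiusSq K n δ * ((gap θ m a) ^ 2)⁻¹ := by
      rw [← div_eq_mul_inv, le_div_iff₀ (by positivity)]
      exact h6
    rw [Nat.cast_sub (by omega)] at h7
    push_cast at h7
    linarith
  · have : (pulls A a n : ℝ) ≤ 1 := by exact_mod_cast (show pulls A a n ≤ 1 by omega)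
    have : 0 ≤ 2 * radiusSq K n δ * ((gap θ m a) ^ 2)⁻¹ := by positivity
    linarith

/-! ### Errors at the stopping time -/

/-- A wrong recommendation at the stopping time comes with a deviation above the threshold. -/
theorem FollowsAPGAI.exists_deviation_of_isError (hK : 1 ≤ K) (hδ : δ ∈ Set.Ioo (0 : ℝ) 1)
    (h : FollowsAPGAI θ A X) (htau : tau θ δ A X ≠ ⊤)
    (herr : IsError θ m (recommendation θ A X (tau θ δ A X).toNat)) :
    ∃ a t, 1 ≤ pulls A a t ∧ pulls A a t * (2 * threshold K t δ) ≤ centeredSum m A X a t ^ 2 := by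
  obtain ⟨hKt, hcross⟩ := tau_toNat_spec htau
  set t := (tau θ δ A X).toNat
  have hc := three_le_threshold hK hδ (hK.trans hKt)
  have hsc : 0 < √(2 * threshold K t δ) := Real.sqrt_pos.2 (by linarith)
  suffices hmain : ∃ a, √(2 * threshold K t δ) ≤ deviation θ m A X a t by
    obtain ⟨a, ha⟩ := hmain
    have hN := h.one_le_pulls a hKt
    refine ⟨a, t, hN, ?_⟩
    have hs := h.sqrt_pulls_pos a hKt
    unfold deviation at ha
    rw [le_div_iff₀ hs] at ha
    have h1 := pow_le_pow_left₀ (by positivity) ha 2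
    rw [mul_pow, mul_pow, armSign_sq, Real.sq_sqrt (by linarith),
      Real.sq_sqrt (Nat.cast_nonneg _)] at h1
    linarith
  have hgapnn : ∀ a, 0 ≤ √(pulls A a t : ℝ) * gap θ m a :=
    fun a => mul_nonneg (Real.sqrt_nonneg _) (abs_nonneg _)
  by_cases hall : ∀ a, empMean A X a t ≤ θ
  · have hrec : recommendation θ A X t = none := by
      unfold recommendation; rw [if_pos hall]
    rw [hrec] at herr
    rcases herr with ⟨⟨g, hg⟩, _⟩ | ⟨_, h2⟩
    · rcases hcross with ⟨a, ha⟩ | ha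
      -- With all empirical means at most `θ`, stopping must come from `W⁻`, which then crosses for
      -- every arm, the good arm `g` included.
      · exact absurd (Wplus_eq_of_pos (hsc.trans_le ha)).1 (not_lt.2 (hall a))
      · refine ⟨g, ?_⟩
        have h1 := ha g
        rw [(Wminus_eq_of_pos (hsc.trans_le h1)).2,
          signedIndex_of_mem (h.one_le_pulls g hKt) hg] at h1
        linarith [hgapnn g]
    · exact absurd rfl h2
  · have hrec : recommendation θ A X t = some (A t) := by
      unfold recommendation; rw [if_neg hall]
    rw [hrec] at herr
    have hbad : A t ∉ goodArms θ m := by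
      rcases herr with ⟨_, h2⟩ | ⟨h1, _⟩
      · intro hc
        exact h2 _ hc rfl
      · rw [h1]; exact Finset.notMem_empty _
    push Not at hall
    obtain ⟨c, hcθ⟩ := hall
    rcases hcross with ⟨a, ha⟩ | ha
    · refine ⟨A t, ?_⟩
      -- The crossing arm need not be the recommended one, but the recommended one maximises `W⁺`
      -- and so crosses too.
      have h1 := ha.trans ((h.2 t hKt).2 ⟨c, hcθ⟩ a)
      rw [(Wplus_eq_of_pos (hsc.trans_le h1)).2,
        signedIndex_of_notMem (h.one_le_pulls (A t) hKt) hbad] at h1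
      linarith [hgapnn (A t)]
    · exact absurd (Wminus_eq_of_pos (hsc.trans_le (ha c))).1 (not_lt.2 hcθ.le)

end Trajectory

/-! ### Geometric series and tail sums. -/

theorem tsum_exp_neg_mul {x : ℝ} (hx : 0 < x) :
    ∑' i : ℕ, ENNReal.ofReal (Real.exp (-(i * x))) = ENNReal.ofReal (1 - Real.exp (-x))⁻¹ := by
  have hlt : Real.exp (-x) < 1 := by rw [Real.exp_lt_one_iff]; linarith
  have hs := hasSum_geometric_of_lt_one (Real.exp_pos (-x)).le hlt
  rw [← hs.tsum_eq, ENNReal.ofReal_tsum_of_nonneg (fun n => by positivity) hs.summable]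
  congr 1
  funext i
  rw [← Real.exp_nat_mul]
  congr 2
  ring

theorem tsum_exp_neg_mul_le {x : ℝ} (hx : 0 < x) :
    ∑' i : ℕ, ENNReal.ofReal (Real.exp (-(i * x))) ≤ ENNReal.ofReal (1 + 1 / x) := by
  rw [tsum_exp_neg_mul hx]
  apply ENNReal.ofReal_le_ofReal
  have h1 : Real.exp (-x) ≤ (1 + x)⁻¹ := by
    rw [Real.exp_neg]
    apply inv_anti₀ (by linarith)
    linarith [Real.add_one_le_exp x]
  have h2 : x / (1 + x) ≤ 1 - Real.exp (-x) := by
    have : x / (1 + x) = 1 - (1 + x)⁻¹ := by field_simp; ring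
    linarith
  calc (1 - Real.exp (-x))⁻¹ ≤ (x / (1 + x))⁻¹ := inv_anti₀ (by positivity) h2
    _ = 1 + 1 / x := by field_simp; ring

theorem tsum_exp_neg_succ_mul_le {x : ℝ} (hx : 0 < x) :
    ∑' i : ℕ, ENNReal.ofReal (Real.exp (-((i + 1 : ℕ) * x))) ≤ ENNReal.ofReal (1 / x) := by
  have h1 : ∀ i : ℕ, ENNReal.ofReal (Real.exp (-((i + 1 : ℕ) * x)))
      = ENNReal.ofReal (Real.exp (-x)) * ENNReal.ofReal (Real.exp (-(i * x))) := by
    intro i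
    rw [← ENNReal.ofReal_mul (Real.exp_pos _).le, ← Real.exp_add]
    congr 2
    push_cast
    ring
  simp_rw [h1]
  rw [ENNReal.tsum_mul_left, tsum_exp_neg_mul hx, ← ENNReal.ofReal_mul (Real.exp_pos _).le]
  apply ENNReal.ofReal_le_ofReal
  have hlt : 0 < 1 - Real.exp (-x) := by
    have : Real.exp (-x) < 1 := by rw [Real.exp_lt_one_iff]; linarith
    linarith
  rw [← div_eq_mul_inv, div_le_div_iff₀ hlt hx, one_mul]
  have h2 : Real.exp (-x) * Real.exp x = 1 := by rw [← Real.exp_add]; simp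
  nlinarith [Real.add_one_le_exp x, Real.exp_pos (-x)]

/-- The pathwise form of the tail-sum formula for expectations; it also covers an infinite stopping
time. -/
theorem natCast_le_add_tsum (x : ℕ∞) (N : ℕ) :
    (x : ℝ≥0∞) ≤ N + ∑' i : ℕ, {y : ℕ∞ | ((N + i : ℕ) : ℕ∞) < y}.indicator (fun _ => 1) x := by
  classical
  induction x with
  | top =>
    have h1 : ∀ i : ℕ, {y : ℕ∞ | ((N + i : ℕ) : ℕ∞) < y}.indicator (fun _ => (1 : ℝ≥0∞)) ⊤ = 1 := by
      intro i
      apply Set.indicator_of_mem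
      exact ENat.natCast_lt_top _
    simp_rw [h1]
    rw [ENNReal.tsum_const_eq_top_of_ne_zero one_ne_zero]
    simp
  | coe n =>
    by_cases hn : n ≤ N
    · refine le_trans ?_ le_self_add
      simpa using hn
    · have h1 : ((n - N : ℕ) : ℝ≥0∞) ≤ ∑' i : ℕ,
          {y : ℕ∞ | ((N + i : ℕ) : ℕ∞) < y}.indicator (fun _ => (1 : ℝ≥0∞)) n := by
        refine le_trans ?_ (ENNReal.sum_le_tsum (Finset.range (n - N)))
        have h2 : ∀ i ∈ Finset.range (n - N),
            {y : ℕ∞ | ((N + i : ℕ) : ℕ∞) < y}.indicator (fun _ => (1 : ℝ≥0∞)) n = 1 := by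
          intro i hi
          apply Set.indicator_of_mem
          have := Finset.mem_range.1 hi
          change ((N + i : ℕ) : ℕ∞) < n
          exact_mod_cast (by omega : N + i < n)
        rw [Finset.sum_congr rfl h2]
        simp
      calc ((n : ℕ∞) : ℝ≥0∞) = (N : ℝ≥0∞) + ((n - N : ℕ) : ℝ≥0∞) := by
            rw [← Nat.cast_add, Nat.add_sub_cancel' (by omega)]
            simp
        _ ≤ _ := by gcongr

/-! ### Error probability, good events and excess pulls. -/

section Run

variable {K : ℕ} {Ω : Type*} [MeasurableSpace Ω] {P : Measure Ω} [IsProbabilityMeasure P]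
  {θ δ : ℝ} {ν : Fin K → Measure ℝ} {A : ℕ → Ω → Fin K} {X : ℕ → Ω → ℝ}

/-- `δ`-correctness of the stopping rule. -/
theorem IsAPGAIRun.measure_isError_le (hK : 1 ≤ K) (hδ : δ ∈ Set.Ioo (0 : ℝ) 1)
    (h : IsAPGAIRun P θ ν A X) (hν : IsSubGaussianInstance ν) :
    P {ω | tau θ δ (fun t => A t ω) (fun t => X t ω) ≠ ⊤ ∧
        IsError θ (mean ν) (recommendation θ (fun t => A t ω) (fun t => X t ω)
          (tau θ δ (fun t => A t ω) (fun t => X t ω)).toNat)} ≤ ENNReal.ofReal δ := by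
  have hK0 : (0 : ℝ) < K := by positivity
  calc _ ≤ P (⋃ a, {ω | ∃ t, 1 ≤ pulls (fun s => A s ω) a t ∧
        pulls (fun s => A s ω) a t * (2 * threshold K t δ)
          ≤ centeredSum (mean ν) (fun s => A s ω) (fun s => X s ω) a t ^ 2}) := by
        apply measure_mono_ae
        filter_upwards [h.follows] with ω hω herr
        have herr' : tau θ δ (fun t => A t ω) (fun t => X t ω) ≠ ⊤ ∧
          IsError θ (mean ν) (recommendation θ (fun t => A t ω) (fun t => X t ω)
          (tau θ δ (fun t => A t ω) (fun t => X t ω)).toNat) := herr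
        obtain ⟨a, ha⟩ := hω.exists_deviation_of_isError hK hδ herr'.1 herr'.2
        exact Set.mem_iUnion.2 ⟨a, ha⟩
    _ ≤ ∑ a, _ := measure_iUnion_fintype_le _ _
    _ ≤ ∑ _a : Fin K, ENNReal.ofReal (δ / K) := by
        gcongr with a
        exact measure_threshold_deviation_le hK h hν a hδ
    _ = ENNReal.ofReal δ := by
        rw [Finset.sum_const, Finset.card_univ, Fintype.card_fin, nsmul_eq_mul,
          ← ENNReal.ofReal_natCast, ← ENNReal.ofReal_mul hK0.le]
        congr 1
        field_simp

/-- Up to round `n`, all deviations are at most `√(6 log n)` outside of an event of probability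
at most `K / n ^ 2`. -/
theorem IsAPGAIRun.exists_deviation_event (h : IsAPGAIRun P θ ν A X)
    (hν : IsSubGaussianInstance ν) {n : ℕ} (hn : 1 ≤ n) :
    ∃ F : Set Ω, MeasurableSet F ∧ P F ≤ ENNReal.ofReal (K * (1 / (n : ℝ) ^ 2)) ∧
      ∀ ω ∉ F, ∀ a s, s ≤ n → 1 ≤ pulls (fun s => A s ω) a s →
        deviation θ (mean ν) (fun s => A s ω) (fun s => X s ω) a s ≤ √(6 * Real.log n) := by
  have hn0 : (0 : ℝ) < n := by positivity
  have hL := log_nat_nonneg n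
  -- The union runs over pull counts `j ≤ n`, with all rounds handled at once, so `n` events of
  -- probability `n⁻³` suffice per arm.
  set E : Fin K → ℕ → Set Ω := fun a j => {ω | ∃ t, pulls (fun s => A s ω) a t = j ∧
    √j * √(6 * Real.log n) ≤ armSign θ (mean ν) a
      * centeredSum (mean ν) (fun s => A s ω) (fun s => X s ω) a t} with hE
  have hPE : ∀ a, ∀ j ∈ Finset.Icc 1 n, P (E a j) ≤ ENNReal.ofReal (1 / (n : ℝ) ^ 3) := by
    intro a j hj
    have h1 := measure_deviation_le h hν a (armSign_sq (θ := θ) (m := mean ν) a)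
      (Finset.mem_Icc.1 hj).1 (y := 6 * Real.log n) (by positivity)
    refine h1.trans (ENNReal.ofReal_le_ofReal (le_of_eq ?_))
    rw [show -(6 * Real.log n / 2) = -Real.log ((n : ℝ) ^ 3) by rw [Real.log_pow]; push_cast; ring,
      Real.exp_neg, Real.exp_log (by positivity), one_div]
  -- Passing to the measurable hull keeps the probability and avoids proving the events measurable.
  refine ⟨toMeasurable P (⋃ a, ⋃ j ∈ Finset.Icc 1 n, E a j), measurableSet_toMeasurable _ _, ?_, ?_⟩
  · rw [measure_toMeasurable]
    calc _ ≤ ∑ a, P (⋃ j ∈ Finset.Icc 1 n, E a j) := measure_iUnion_fintype_le _ _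
      _ ≤ ∑ _a : Fin K, ∑ _j ∈ Finset.Icc 1 n, ENNReal.ofReal (1 / (n : ℝ) ^ 3) := by
          apply Finset.sum_le_sum
          intro a _
          exact (measure_biUnion_finset_le _ _).trans (Finset.sum_le_sum (hPE a))
      _ = ENNReal.ofReal (K * (1 / (n : ℝ) ^ 2)) := by
          rw [Finset.sum_const, Finset.sum_const, Finset.card_univ, Fintype.card_fin,
            Nat.card_Icc, Nat.add_sub_cancel, nsmul_eq_mul, nsmul_eq_mul,
            ← ENNReal.ofReal_natCast, ← ENNReal.ofReal_natCast,
            ← ENNReal.ofReal_mul hn0.le, ← ENNReal.ofReal_mul (Nat.cast_nonneg K)]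
          congr 1
          field_simp
  · intro ω hω a s hs hN
    by_contra! hc
    apply hω
    apply subset_toMeasurable
    refine Set.mem_iUnion.2 ⟨a, Set.mem_iUnion₂.2 ⟨pulls (fun s => A s ω) a s,
      Finset.mem_Icc.2 ⟨hN, (pulls_le _ _ _).trans hs⟩, s, rfl, ?_⟩⟩
    have hsq : 0 < √(pulls (fun s => A s ω) a s : ℝ) := Real.sqrt_pos.2 (by exact_mod_cast hN)
    unfold deviation at hc
    rw [lt_div_iff₀ hsq] at hc
    linarith

/-- A random variable of small expectation bounds the number of pulls of the arms that do not
enter the complexity beyond a deterministic number. -/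
theorem IsAPGAIRun.exists_excess (hK : 1 ≤ K) (h : IsAPGAIRun P θ ν A X)
    (hν : IsSubGaussianInstance ν) (hμ : ∀ a, mean ν a ≠ θ) :
    ∃ R : Ω → ℝ≥0∞, Measurable R ∧ ∫⁻ ω, R ω ∂P ≤ ENNReal.ofReal (1 / 4) ∧
      ∀ ω, FollowsAPGAI θ (fun t => A t ω) (fun t => X t ω) → ∀ n,
        ENNReal.ofReal (∑ b ∈ (relevantArms θ (mean ν))ᶜ, (pulls (fun s => A s ω) b n : ℝ))
          ≤ ENNReal.ofReal ((relevantArms θ (mean ν))ᶜ.card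
            + 12 * (H1 θ (mean ν) - H θ (mean ν)) * Real.log (Sμ θ (mean ν))) + R ω := by
  rcases (goodArms θ (mean ν)).eq_empty_or_nonempty with hg | hg
  · refine ⟨fun _ => 0, measurable_const, by simp, ?_⟩
    intro ω _ n
    simp [relevantArms_of_empty hg]
  set μ := mean ν with hμdef
  rw [relevantArms_of_nonempty hg]
  obtain ⟨a, ha⟩ := hg
  have hS3 := three_le_Sμ hK hμ ⟨a, ha⟩
  have hlog := one_le_log_Sμ hK hμ ⟨a, ha⟩
  set S := Sμ θ μ with hS
  -- Beyond `f b` pulls, `N_b Δ_b² ≥ 12 log S`, which after division by `4` gives the factor `S⁻³`.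
  set f : Fin K → ℕ := fun b => ⌊12 * Real.log S * ((gap θ μ b) ^ 2)⁻¹⌋₊ with hf
  set E : Fin K → ℕ → ℕ → Set Ω := fun b i j => {ω | ∃ t,
    pulls (fun s => A s ω) a t = j + 1 ∧ pulls (fun s => A s ω) b t = f b + 1 + i ∧
    √(j + 1 : ℕ) * gap θ μ a + √(f b + 1 + i : ℕ) * gap θ μ b
      ≤ armSign θ μ a * centeredSum μ (fun s => A s ω) (fun s => X s ω) a t / √(j + 1 : ℕ)
        + armSign θ μ b * centeredSum μ (fun s => A s ω) (fun s => X s ω) b t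
          / √(f b + 1 + i : ℕ)} with hE
  have hga := gap_pos hμ a
  have hPE : ∀ b ∈ (goodArms θ μ)ᶜ, ∀ i j, P (E b i j) ≤ ENNReal.ofReal (1 / S ^ 3)
      * (ENNReal.ofReal (Real.exp (-(i * (gap θ μ b ^ 2 / 4))))
        * ENNReal.ofReal (Real.exp (-((j + 1 : ℕ) * (gap θ μ a ^ 2 / 4))))) := by
    intro b hb i j
    have hb' : b ∉ goodArms θ μ := Finset.mem_compl.1 hb
    have hab : a ≠ b := fun hc => hb' (hc ▸ ha)
    have hgb := gap_pos hμ b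
    refine (measure_pair_deviation_le h hν hab (armSign_sq a) (armSign_sq b)
      (show 1 ≤ j + 1 by omega) (show 1 ≤ f b + 1 + i by omega)
      (y := √(j + 1 : ℕ) * gap θ μ a + √(f b + 1 + i : ℕ) * gap θ μ b) (by positivity)).trans ?_
    rw [← ENNReal.ofReal_mul (Real.exp_pos _).le, ← ENNReal.ofReal_mul (by positivity)]
    apply ENNReal.ofReal_le_ofReal
    have hS0 : 0 < S := by linarith
    have hexpS : 1 / S ^ 3 = Real.exp (-(3 * Real.log S)) := by
      rw [show 3 * Real.log S = Real.log (S ^ 3) by rw [Real.log_pow]; norm_num, Real.exp_neg,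
        Real.exp_log (by positivity), one_div]
    rw [hexpS, ← Real.exp_add, ← Real.exp_add, Real.exp_le_exp]
    have h1 : ((j + 1 : ℕ) : ℝ) * gap θ μ a ^ 2 + ((f b + 1 + i : ℕ) : ℝ) * gap θ μ b ^ 2
        ≤ (√(j + 1 : ℕ) * gap θ μ a + √(f b + 1 + i : ℕ) * gap θ μ b) ^ 2 := by
      have e1 := Real.sq_sqrt (Nat.cast_nonneg (α := ℝ) (j + 1))
      have e2 := Real.sq_sqrt (Nat.cast_nonneg (α := ℝ) (f b + 1 + i))
      have e3 : 0 ≤ (√(j + 1 : ℕ) * gap θ μ a) * (√(f b + 1 + i : ℕ) * gap θ μ b) := by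
        positivity
      calc _ = (√(j + 1 : ℕ) * gap θ μ a) ^ 2 + (√(f b + 1 + i : ℕ) * gap θ μ b) ^ 2 := by
            rw [mul_pow, mul_pow, e1, e2]
        _ ≤ _ := by nlinarith
    have h2 : 12 * Real.log S + i * gap θ μ b ^ 2
        ≤ ((f b + 1 + i : ℕ) : ℝ) * gap θ μ b ^ 2 := by
      have e1 := Nat.lt_floor_add_one (12 * Real.log S * ((gap θ μ b) ^ 2)⁻¹)
      have e2 : 12 * Real.log S ≤ ((f b : ℝ) + 1) * gap θ μ b ^ 2 := by
        rw [← div_le_iff₀ (by positivity), div_eq_mul_inv]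
        exact e1.le
      push_cast
      linarith
    linarith
  -- `R` counts pairs of pull counts of `b` and of the fixed good arm `a` at which a joint deviation
  -- occurs; it depends on neither `n` nor `δ`.
  set R : Ω → ℝ≥0∞ := fun ω => ∑ b ∈ (goodArms θ μ)ᶜ, ∑' i : ℕ, ∑' j : ℕ,
    (toMeasurable P (E b i j)).indicator (fun _ => 1) ω with hR
  have hind : ∀ b i j, Measurable ((toMeasurable P (E b i j)).indicator fun _ => (1 : ℝ≥0∞)) :=
    fun b i j => measurable_const.indicator (measurableSet_toMeasurable _ _)
  refine ⟨R, ?_, ?_, ?_⟩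
  · exact Finset.measurable_sum _ fun b _ => Measurable.tsum fun i =>
      Measurable.tsum fun j => hind b i j
  · have h1 : ∫⁻ ω, R ω ∂P = ∑ b ∈ (goodArms θ μ)ᶜ, ∑' i : ℕ, ∑' j : ℕ, P (E b i j) := by
      rw [lintegral_finsetSum _ fun b _ => Measurable.tsum fun i =>
        Measurable.tsum fun j => hind b i j]
      apply Finset.sum_congr rfl
      intro b _
      rw [lintegral_tsum fun i => (Measurable.tsum fun j => hind b i j).aemeasurable]
      congr 1; funext i
      rw [lintegral_tsum fun j => (hind b i j).aemeasurable]
      congr 1; funext j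
      rw [lintegral_indicator (measurableSet_toMeasurable _ _), lintegral_one,
        Measure.restrict_apply_univ, measure_toMeasurable]
    rw [h1]
    have h2 : ∀ b ∈ (goodArms θ μ)ᶜ, ∑' i : ℕ, ∑' j : ℕ, P (E b i j)
        ≤ ENNReal.ofReal (1 / S ^ 3 * ((1 + 4 * (gap θ μ b ^ 2)⁻¹) * (4 * (gap θ μ a ^ 2)⁻¹))) := by
      intro b hb
      have hgb := gap_pos hμ b
      calc ∑' i : ℕ, ∑' j : ℕ, P (E b i j)
          ≤ ∑' i : ℕ, ∑' j : ℕ, ENNReal.ofReal (1 / S ^ 3)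
      * (ENNReal.ofReal (Real.exp (-(i * (gap θ μ b ^ 2 / 4))))
        * ENNReal.ofReal (Real.exp (-((j + 1 : ℕ) * (gap θ μ a ^ 2 / 4))))) :=
            ENNReal.tsum_le_tsum fun i => ENNReal.tsum_le_tsum fun j => hPE b hb i j
        _ = ENNReal.ofReal (1 / S ^ 3)
            * ((∑' i : ℕ, ENNReal.ofReal (Real.exp (-(i * (gap θ μ b ^ 2 / 4)))))
            * ∑' j : ℕ, ENNReal.ofReal (Real.exp (-((j + 1 : ℕ) * (gap θ μ a ^ 2 / 4))))) := by
            simp_rw [ENNReal.tsum_mul_left]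
            rw [ENNReal.tsum_mul_right]
        _ ≤ ENNReal.ofReal (1 / S ^ 3) * (ENNReal.ofReal (1 + 1 / (gap θ μ b ^ 2 / 4))
            * ENNReal.ofReal (1 / (gap θ μ a ^ 2 / 4))) := by
            gcongr
            · exact tsum_exp_neg_mul_le (by positivity)
            · exact tsum_exp_neg_succ_mul_le (by positivity)
        _ = _ := by
            rw [← ENNReal.ofReal_mul (by positivity), ← ENNReal.ofReal_mul (by positivity)]
            congr 1
            field_simp
    refine (Finset.sum_le_sum h2).trans ?_
    have hG := inv_gap_sq_pos hμ a
    rw [← ENNReal.ofReal_sum_of_nonneg fun b _ => by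
      have := inv_gap_sq_pos hμ b
      positivity]
    apply ENNReal.ofReal_le_ofReal
    rw [← Finset.mul_sum, ← Finset.sum_mul, Finset.sum_add_distrib, ← Finset.mul_sum,
      Finset.sum_const, nsmul_eq_mul, mul_one]
    have hB := sum_inv_gap_sq_le_H1 hμ (goodArms θ μ)ᶜ
    have hB0 : 0 ≤ ∑ b ∈ (goodArms θ μ)ᶜ, (gap θ μ b ^ 2)⁻¹ :=
      Finset.sum_nonneg fun b _ => (inv_gap_sq_pos hμ b).le
    have hG1 := inv_gap_sq_le_H1 hμ a
    have hH := (le_Sμ hK hμ).2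
    have hKS := (le_Sμ hK hμ).1
    have hcard : ((goodArms θ μ)ᶜ.card : ℝ) ≤ S := by
      have := Finset.card_le_univ (goodArms θ μ)ᶜ
      rw [Fintype.card_fin] at this
      have h3 : ((goodArms θ μ)ᶜ.card : ℝ) ≤ K := by exact_mod_cast this
      have h4 : (0 : ℝ) ≤ (goodArms θ μ).card := Nat.cast_nonneg _
      linarith
    have hS0 : 0 < S := by linarith
    have h3 : (goodArms θ μ)ᶜ.card + 4 * ∑ b ∈ (goodArms θ μ)ᶜ, (gap θ μ b ^ 2)⁻¹ ≤ 4 / 3 * S := by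
      linarith
    have h4 : 4 * (gap θ μ a ^ 2)⁻¹ ≤ 1 / 3 * S := by linarith
    -- The two geometric sums cost at most `S²` up to a constant, since `K ≤ S` and `12 H₁ ≤ S`; the
    -- remaining `1/S` is controlled by `S ≥ 3`.
    calc 1 / S ^ 3 * (((goodArms θ μ)ᶜ.card + 4 * ∑ b ∈ (goodArms θ μ)ᶜ, (gap θ μ b ^ 2)⁻¹)
          * (4 * (gap θ μ a ^ 2)⁻¹))
        ≤ 1 / S ^ 3 * ((4 / 3 * S) * (1 / 3 * S)) := by gcongr
      _ = (4 / 9) / S := by field_simp; norm_num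
      _ ≤ (4 / 9) / 3 := by gcongr
      _ ≤ 1 / 4 := by norm_num
  · intro ω hω n
    have hpull : ∀ b ∈ (goodArms θ μ)ᶜ, ENNReal.ofReal (pulls (fun s => A s ω) b n : ℝ)
        ≤ ENNReal.ofReal (1 + 12 * Real.log S * (gap θ μ b ^ 2)⁻¹) + ∑' i : ℕ, ∑' j : ℕ,
          (toMeasurable P (E b i j)).indicator (fun _ => 1) ω := by
      intro b hb
      have hb' : b ∉ goodArms θ μ := Finset.mem_compl.1 hb
      have hgb := inv_gap_sq_pos hμ b
      set p := pulls (fun s => A s ω) b n with hp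
      -- Each count of `b` above `f b` and below `p` was left at an adaptive round where `b` beat
      -- `a`; the count of `a` at that round selects the index `j`.
      have hone : ∀ i ∈ Finset.range (p - 1 - f b), (1 : ℝ≥0∞) ≤ ∑' j : ℕ,
          (toMeasurable P (E b i j)).indicator (fun _ => 1) ω := by
        intro i hi
        have hi' := Finset.mem_range.1 hi
        obtain ⟨s, hKs, _, hAs, hNs⟩ := hω.exists_round (a := b) (k := f b + 1 + i) (n := n)
          (by omega) (by omega)
        have hNa := hω.one_le_pulls a hKs
        have hle := hω.le_deviation_add (m := μ) hKs ha (by rw [hAs]; exact hb')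
        rw [hAs] at hle
        unfold deviation at hle
        rw [hNs] at hle
        obtain ⟨j, hj⟩ := Nat.exists_eq_succ_of_ne_zero
          (show pulls (fun s => A s ω) a s ≠ 0 by omega)
        rw [hj] at hle
        have hmem : ω ∈ toMeasurable P (E b i j) := subset_toMeasurable _ _ ⟨s, hj, hNs, hle⟩
        refine le_trans (le_of_eq ?_) (ENNReal.le_tsum j)
        rw [Set.indicator_of_mem hmem]
      have hcount : ((p - 1 - f b : ℕ) : ℝ≥0∞) ≤ ∑' i : ℕ, ∑' j : ℕ,
          (toMeasurable P (E b i j)).indicator (fun _ => 1) ω := by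
        refine le_trans ?_ (ENNReal.sum_le_tsum (Finset.range (p - 1 - f b)))
        refine le_trans (le_of_eq ?_) (Finset.sum_le_sum hone)
        simp
      have hfl : (f b : ℝ) ≤ 12 * Real.log S * (gap θ μ b ^ 2)⁻¹ := Nat.floor_le (by positivity)
      have hp' : (p : ℝ) ≤ (1 + f b) + (p - 1 - f b : ℕ) := by
        exact_mod_cast (by omega : p ≤ 1 + f b + (p - 1 - f b))
      calc ENNReal.ofReal (p : ℝ) ≤ ENNReal.ofReal ((1 + f b) + (p - 1 - f b : ℕ)) :=
            ENNReal.ofReal_le_ofReal hp'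
        _ = ENNReal.ofReal (1 + f b) + (p - 1 - f b : ℕ) := by
            rw [ENNReal.ofReal_add (by positivity) (by positivity), ENNReal.ofReal_natCast]
        _ ≤ _ := by gcongr
    rw [ENNReal.ofReal_sum_of_nonneg fun b _ => Nat.cast_nonneg _]
    refine (Finset.sum_le_sum hpull).trans (le_of_eq ?_)
    rw [Finset.sum_add_distrib]
    congr 1
    rw [← ENNReal.ofReal_sum_of_nonneg fun b _ => by
      have := inv_gap_sq_pos hμ b
      positivity]
    congr 1
    rw [Finset.sum_add_distrib, Finset.sum_const, nsmul_eq_mul, mul_one, ← Finset.mul_sum,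
      H1_eq_H_add, relevantArms_of_nonempty ⟨a, ha⟩]
    ring

end Run

theorem mul_log_Sμ_nonneg {K : ℕ} (hK : 1 ≤ K) {θ : ℝ} {μ : Fin K → ℝ} (hμ : ∀ a, μ a ≠ θ) :
    0 ≤ (H1 θ μ - H θ μ) * Real.log (Sμ θ μ) := by
  rcases (goodArms θ μ).eq_empty_or_nonempty with hg | hg
  · rw [H_of_empty hg]
    simp
  · exact mul_nonneg (sub_nonneg.2 (H_le_H1 hμ)) (by linarith [one_le_log_Sμ hK hμ hg])

/-- The saved first term `1` of the series, multiplied by `K ≥ 1`, later pays for rounding `C` up to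
an integer. -/
theorem tsum_inv_sq_le {N : ℕ} (hN : 2 ≤ N) {c : ℝ} (hc : 0 ≤ c) :
    ∑' i : ℕ, ENNReal.ofReal (c * (1 / ((N + i : ℕ) : ℝ) ^ 2))
      ≤ ENNReal.ofReal (c * (Real.pi ^ 2 / 6 - 1)) := by
  have h1 : HasSum (fun i : ℕ => 1 / ((i + 2 : ℕ) : ℝ) ^ 2) (Real.pi ^ 2 / 6 - 1) := by
    have := (hasSum_nat_add_iff' (f := fun n : ℕ => 1 / (n : ℝ) ^ 2) 2).2 hasSum_zeta_two
    simpa [Finset.sum_range_succ] using this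
  have h2 := h1.mul_left c
  rw [← h2.tsum_eq, ENNReal.ofReal_tsum_of_nonneg (fun i => by positivity) h2.summable]
  apply ENNReal.tsum_le_tsum
  intro i
  apply ENNReal.ofReal_le_ofReal
  have hle : ((i + 2 : ℕ) : ℝ) ≤ ((N + i : ℕ) : ℝ) := by
    exact_mod_cast (by omega : i + 2 ≤ N + i)
  exact mul_le_mul_of_nonneg_left (one_div_le_one_div_of_le (by positivity)
    (pow_le_pow_left₀ (by positivity) hle 2)) hc

/-! ### Expected sample complexity. -/

section Run

variable {K : ℕ} {Ω : Type*} [MeasurableSpace Ω] {P : Measure Ω} [IsProbabilityMeasure P]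
  {θ δ : ℝ} {ν : Fin K → Measure ℝ} {A : ℕ → Ω → Fin K} {X : ℕ → Ω → ℝ}

/-- The expected sample complexity at every confidence level. -/
theorem IsAPGAIRun.expTau_le (hK : 1 ≤ K) (hδ : δ ∈ Set.Ioo (0 : ℝ) 1)
    (h : IsAPGAIRun P θ ν A X) (hν : IsSubGaussianInstance ν) (hμ : ∀ a, mean ν a ≠ θ) :
    expTau P θ δ A X ≤ ENNReal.ofReal (C θ (mean ν) δ + K * Real.pi ^ 2 / 6 + 1) := by
  set μ := mean ν with hμdef
  have hK1 : (1 : ℝ) ≤ K := by exact_mod_cast hK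
  have hC1 : 1 ≤ C θ μ δ := (isLUB_C hK hμ hδ).1 (one_mem_Cset hK hμ δ)
  set N := ⌊C θ μ δ⌋₊ + 1 with hN
  have hCN : C θ μ δ < N := by
    rw [hN]; push_cast; exact Nat.lt_floor_add_one _
  have hNC : (N : ℝ) ≤ C θ μ δ + 1 := by
    rw [hN]; push_cast
    linarith [Nat.floor_le (show 0 ≤ C θ μ δ by linarith)]
  have hN2 : 2 ≤ N := by
    have : 1 ≤ ⌊C θ μ δ⌋₊ := Nat.le_floor (by simpa using hC1)
    omega
  have hF : ∀ i : ℕ, ∃ F : Set Ω, MeasurableSet F ∧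
      P F ≤ ENNReal.ofReal (K * (1 / ((N + i : ℕ) : ℝ) ^ 2)) ∧
      ∀ ω ∉ F, ∀ a s, s ≤ N + i → 1 ≤ pulls (fun s => A s ω) a s →
        deviation θ μ (fun s => A s ω) (fun s => X s ω) a s
          ≤ √(6 * Real.log (N + i : ℕ)) :=
    fun i => h.exists_deviation_event hν (by omega)
  choose F hFm hFP hFdev using hF
  obtain ⟨R, hRm, hRint, hR⟩ := h.exists_excess hK hν hμ
  have hpath : ∀ᵐ ω ∂P, ((tau θ δ (fun t => A t ω) (fun t => X t ω) : ℕ∞) : ℝ≥0∞)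
      ≤ N + ∑' i : ℕ, (F i).indicator (fun _ => 1) ω + 4 * R ω := by
    filter_upwards [h.follows] with ω hω
    by_cases htop : R ω = ⊤
    · rw [htop]; simp
    set r := (R ω).toReal with hr
    have hRr : R ω = ENNReal.ofReal r := (ENNReal.ofReal_toReal htop).symm
    have hr0 : 0 ≤ r := ENNReal.toReal_nonneg
    -- The `1` subtracted here comes from the spare unit in `le_D`; it offsets the rounding, so that
    -- `M ≤ 4 r`.
    set M := ⌈4 * (r - 1)⌉₊ with hM
    have hM4 : (M : ℝ) ≤ 4 * r := by
      by_cases hr1 : r ≤ 1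
      · have : M = 0 := Nat.ceil_eq_zero.2 (by linarith)
        rw [this]; push_cast; linarith
      · linarith [Nat.ceil_lt_add_one (show 0 ≤ 4 * (r - 1) by linarith)]
    have hterm : ∀ i : ℕ, {y : ℕ∞ | ((N + i : ℕ) : ℕ∞) < y}.indicator (fun _ => (1 : ℝ≥0∞))
        (tau θ δ (fun t => A t ω) (fun t => X t ω))
        ≤ (F i).indicator (fun _ => 1) ω
          + {i : ℕ | i < M}.indicator (fun _ => 1) i := by
      intro i
      classical
      by_cases hlt : ((N + i : ℕ) : ℕ∞) < tau θ δ (fun t => A t ω) (fun t => X t ω)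
      swap
      · rw [Set.indicator_of_notMem (by exact hlt)]
        exact zero_le
      by_cases hωF : ω ∈ F i
      · rw [Set.indicator_of_mem hωF]
        exact (Set.indicator_le_self' (fun _ _ => zero_le) _).trans le_self_add
      suffices hiM : i < M by
        rw [Set.indicator_of_mem (show i ∈ {i : ℕ | i < M} from hiM)]
        exact (Set.indicator_le_self' (fun _ _ => zero_le) _).trans le_add_self
      set n := N + i with hn
      have hrel : ∑ a ∈ relevantArms θ μ, (pulls (fun s => A s ω) a n : ℝ)
          ≤ (relevantArms θ μ).card + 2 * H θ μ * radiusSq K n δ := by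
        calc ∑ a ∈ relevantArms θ μ, (pulls (fun s => A s ω) a n : ℝ)
            ≤ ∑ a ∈ relevantArms θ μ, (1 + 2 * radiusSq K n δ * ((gap θ μ a) ^ 2)⁻¹) := by
              apply Finset.sum_le_sum
              intro a ha
              exact hω.pulls_le_of_lt_tau hK hδ hμ hlt ha
                fun s hKs hsn => hFdev i ω hωF a s hsn (hω.one_le_pulls a hKs)
          _ = _ := by
              rw [Finset.sum_add_distrib, Finset.sum_const, nsmul_eq_mul, mul_one,
                ← Finset.mul_sum, ← H_eq_sum]
              ring
      have hcompl : ∑ b ∈ (relevantArms θ μ)ᶜ, (pulls (fun s => A s ω) b n : ℝ)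
          ≤ (relevantArms θ μ)ᶜ.card + 12 * (H1 θ μ - H θ μ) * Real.log (Sμ θ μ) + r := by
        have h1 := hR ω hω n
        have h2 := mul_log_Sμ_nonneg hK hμ
        have h3 : (0 : ℝ) ≤ (relevantArms θ μ)ᶜ.card
            + 12 * (H1 θ μ - H θ μ) * Real.log (Sμ θ μ) := by
          have : (0 : ℝ) ≤ (relevantArms θ μ)ᶜ.card := Nat.cast_nonneg _
          linarith
        rw [hRr, ← ENNReal.ofReal_add h3 hr0] at h1
        exact (ENNReal.ofReal_le_ofReal_iff (by linarith)).1 h1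
      have hcard : ((relevantArms θ μ).card : ℝ) + (relevantArms θ μ)ᶜ.card = K := by
        have := Finset.card_add_card_compl (relevantArms θ μ)
        rw [Fintype.card_fin] at this
        exact_mod_cast this
      have hsum : (n : ℝ) = ∑ a ∈ relevantArms θ μ, (pulls (fun s => A s ω) a n : ℝ)
          + ∑ b ∈ (relevantArms θ μ)ᶜ, (pulls (fun s => A s ω) b n : ℝ) := by
        rw [Finset.sum_add_sum_compl]
        exact_mod_cast (sum_pulls (fun s => A s ω) n).symm
      have hgrow := linear_growth_of_C_lt hK hμ hδ hCN (show N ≤ n by omega)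
      have hD := le_D hK hμ
      have hni : (n : ℝ) = N + i := by rw [hn]; push_cast; ring
      -- The pull counts give `n ≤ 2 H q + D - 1 + r`, while linear growth gives `2 H q + D + i / 4
      -- < n`.
      have hlast : (i : ℝ) < 4 * (r - 1) := by linarith
      exact Nat.lt_ceil.2 hlast
    calc ((tau θ δ (fun t => A t ω) (fun t => X t ω) : ℕ∞) : ℝ≥0∞)
        ≤ N + ∑' i : ℕ, ((F i).indicator (fun _ => 1) ω
          + {i : ℕ | i < M}.indicator (fun _ => 1) i) := by
          refine (natCast_le_add_tsum _ N).trans ?_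
          gcongr with i
          exact hterm i
      _ = N + (∑' i : ℕ, (F i).indicator (fun _ => 1) ω + (M : ℝ≥0∞)) := by
          rw [ENNReal.tsum_add]
          congr 2
          rw [tsum_eq_sum (s := Finset.range M)]
          · rw [Finset.sum_congr rfl (g := fun _ => (1 : ℝ≥0∞))]
            · simp
            · intro i hi
              exact Set.indicator_of_mem (s := {i : ℕ | i < M}) (Finset.mem_range.1 hi) _
          · intro i hi
            exact Set.indicator_of_notMem (s := {i : ℕ | i < M}) (fun hc => hi (Finset.mem_range.2 hc)) _
      _ ≤ N + (∑' i : ℕ, (F i).indicator (fun _ => 1) ω + 4 * R ω) := by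
          gcongr
          rw [hRr, ← ENNReal.ofReal_natCast,
            show (4 : ℝ≥0∞) = ENNReal.ofReal 4 by simp, ← ENNReal.ofReal_mul (by norm_num)]
          exact ENNReal.ofReal_le_ofReal hM4
      _ = _ := by rw [add_assoc]
  have hindm : ∀ i, Measurable ((F i).indicator fun _ => (1 : ℝ≥0∞)) :=
    fun i => measurable_const.indicator (hFm i)
  calc expTau P θ δ A X
      ≤ ∫⁻ ω, (N + ∑' i : ℕ, (F i).indicator (fun _ => 1) ω + 4 * R ω) ∂P :=
        lintegral_mono_ae hpath
    _ = N + ∑' i : ℕ, P (F i) + 4 * ∫⁻ ω, R ω ∂P := by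
        rw [lintegral_add_right _ (hRm.const_mul 4), lintegral_add_left measurable_const,
          lintegral_const_mul _ hRm, lintegral_const, measure_univ, mul_one,
          lintegral_tsum fun i => (hindm i).aemeasurable]
        congr 3
        funext i
        rw [lintegral_indicator (hFm i), lintegral_one, Measure.restrict_apply_univ]
    _ ≤ ENNReal.ofReal N + ENNReal.ofReal (K * (Real.pi ^ 2 / 6 - 1))
        + ENNReal.ofReal 4 * ENNReal.ofReal (1 / 4) := by
        rw [ENNReal.ofReal_natCast]
        gcongr
        · exact (ENNReal.tsum_le_tsum hFP).trans (tsum_inv_sq_le hN2 (Nat.cast_nonneg K))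
        · simp
    _ = ENNReal.ofReal (N + K * (Real.pi ^ 2 / 6 - 1) + 1) := by
        have hpi : 0 ≤ Real.pi ^ 2 / 6 - 1 := by nlinarith [Real.pi_gt_three]
        rw [← ENNReal.ofReal_mul (by norm_num), ← ENNReal.ofReal_add (by positivity)
          (by positivity), ← ENNReal.ofReal_add (by positivity) (by norm_num)]
        norm_num
    -- Here `N ≤ C + 1`, the extra unit being cancelled by `-K ≤ -1`.
    _ ≤ ENNReal.ofReal (C θ μ δ + K * Real.pi ^ 2 / 6 + 1) := by
        apply ENNReal.ofReal_le_ofReal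
        linarith

/-- The asymptotic expected sample complexity. -/
theorem IsAPGAIRun.limsup_expTau_le (hK : 1 ≤ K) (h : IsAPGAIRun P θ ν A X)
    (hν : IsSubGaussianInstance ν) (hμ : ∀ a, mean ν a ≠ θ) :
    limsup (fun δ : ℝ => expTau P θ δ A X / ENNReal.ofReal (Real.log (1 / δ))) (𝓝[>] 0)
      ≤ ENNReal.ofReal (2 * H θ (mean ν)) := by
  have hlim := ENNReal.tendsto_ofReal
    (tendsto_C_div_log hK hμ (K * Real.pi ^ 2 / 6 + 1))
  rw [← hlim.limsup_eq]
  apply limsup_le_limsup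
  · filter_upwards [eventually_mem_Ioo_and_le 1] with δ hδ
    rw [ENNReal.ofReal_div_of_pos (by linarith [hδ.2]), ← add_assoc]
    gcongr
    exact h.expTau_le hK hδ.1 hν hμ
  · isBoundedDefault
  · isBoundedDefault

end Run

/-! ### Gaussian instances. -/

theorem isSubGaussianInstance_gaussianReal {K : ℕ} (m : Fin K → ℝ) :
    IsSubGaussianInstance (fun a => gaussianReal (m a) 1) := by
  intro a
  refine ⟨inferInstance, ?_, ?_⟩
  · intro t
    simp only [mean, integral_id_gaussianReal]
    have h1 := integrable_exp_mul_gaussianReal (μ := m a) (v := 1) t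
    refine (h1.mul_const (Real.exp (-(t * m a)))).congr (Eventually.of_forall fun x => ?_)
    simp only
    rw [← Real.exp_add]
    congr 1
    ring
  · intro t
    simp only [mean, integral_id_gaussianReal]
    have h1 : (gaussianReal (m a) 1).map (fun x => x - m a) = gaussianReal 0 1 := by
      rw [gaussianReal_map_sub_const, sub_self]
    rw [mgf_gaussianReal h1]
    simp

theorem mean_gaussianReal {K : ℕ} (m : Fin K → ℝ) :
    mean (fun a => gaussianReal (m a) 1) = m := by
  funext a
  simp [mean]

end GAI

open GAI
theorem theorem2 (K : ℕ) (hK : 1 ≤ K) (θ : ℝ) :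
    -- delta-correctness
    (∀ δ ∈ Set.Ioo (0 : ℝ) 1, ∀ ν : Fin K → Measure ℝ, IsSubGaussianInstance ν →
      ∀ (Ω : Type u) [MeasurableSpace Ω] (P : Measure Ω) [IsProbabilityMeasure P]
        (A : ℕ → Ω → Fin K) (X : ℕ → Ω → ℝ), IsAPGAIRun P θ ν A X →
        P {ω | tau θ δ (fun t => A t ω) (fun t => X t ω) ≠ ⊤ ∧
            IsError θ (GAI.mean ν) (recommendation θ (fun t => A t ω) (fun t => X t ω)
              (tau θ δ (fun t => A t ω) (fun t => X t ω)).toNat)}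
          ≤ ENNReal.ofReal δ) ∧
    -- the supremum defining the bound is a genuine one
    (∀ δ ∈ Set.Ioo (0 : ℝ) 1, ∀ μ : Fin K → ℝ, (∀ a, μ a ≠ θ) →
      IsLUB (Cset θ μ δ) (GAI.C θ μ δ)) ∧
    -- bound on the expected sample complexity at every confidence level, and its asymptotic form
    (∀ ν : Fin K → Measure ℝ, IsSubGaussianInstance ν → (∀ a, GAI.mean ν a ≠ θ) →
      ∀ (Ω : Type u) [MeasurableSpace Ω] (P : Measure Ω) [IsProbabilityMeasure P]
        (A : ℕ → Ω → Fin K) (X : ℕ → Ω → ℝ), IsAPGAIRun P θ ν A X →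
        (∀ δ ∈ Set.Ioo (0 : ℝ) 1,
          expTau P θ δ A X ≤
            ENNReal.ofReal (GAI.C θ (GAI.mean ν) δ + K * Real.pi ^ 2 / 6 + 1)) ∧
        limsup (fun δ : ℝ => expTau P θ δ A X / ENNReal.ofReal (Real.log (1 / δ))) (𝓝[>] 0)
          ≤ ENNReal.ofReal (2 * GAI.H θ (GAI.mean ν))) ∧
    -- the limit superior matches the characteristic time for Gaussian arms, none of them good
    (∀ m : Fin K → ℝ, (∀ a, m a < θ) →
      ∀ (Ω : Type u) [MeasurableSpace Ω] (P : Measure Ω) [IsProbabilityMeasure P]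
        (A : ℕ → Ω → Fin K) (X : ℕ → Ω → ℝ),
        IsAPGAIRun P θ (fun a => gaussianReal (m a) 1) A X →
        limsup (fun δ : ℝ => expTau P θ δ A X / ENNReal.ofReal (Real.log (1 / δ))) (𝓝[>] 0)
          ≤ ENNReal.ofReal (charTime θ m)) ∧
    -- first-order expansion of the bound as the risk tends to zero
    (∀ μ : Fin K → ℝ, (∀ a, μ a ≠ θ) →
      (fun δ : ℝ => GAI.C θ μ δ - 2 * GAI.H θ μ * Real.log (1 / δ)) =O[𝓝[>] 0]
        (fun δ : ℝ => √(Real.log (1 / δ) * Real.log (Real.log (1 / δ))))) ∧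
    -- order of the additive constant for hard instances
    (∀ R : ℝ, ∃ k₁ k₂ : ℝ, 0 < k₁ ∧ 0 < k₂ ∧ ∀ (θ' : ℝ) (μ : Fin K → ℝ), (∀ a, μ a ≠ θ') →
      (∀ a, gap θ' μ a ≤ R) → 2 ≤ H1 θ' μ →
        k₁ * (H1 θ' μ * Real.log (H1 θ' μ)) ≤ D θ' μ ∧
        D θ' μ ≤ k₂ * (H1 θ' μ * Real.log (H1 θ' μ))) := by
  refine ⟨?_, ?_, ?_, ?_, ?_, ?_⟩
  · intro δ hδ ν hν Ω _ P _ A X h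
    exact h.measure_isError_le hK hδ hν
  · intro δ hδ μ hμ
    exact isLUB_C hK hμ hδ
  · intro ν hν hμ Ω _ P _ A X h
    exact ⟨fun δ hδ => h.expTau_le hK hδ hν hμ, h.limsup_expTau_le hK hν hμ⟩
  · intro m hm Ω _ P _ A X h
    have hg : goodArms θ m = ∅ :=
      Finset.filter_eq_empty_iff.2 fun a _ => not_le.2 (hm a)
    have h1 := h.limsup_expTau_le hK (isSubGaussianInstance_gaussianReal m)
      (by rw [mean_gaussianReal]; exact fun a => (hm a).ne)
    rw [mean_gaussianReal, H_of_empty hg] at h1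
    unfold charTime
    rwa [if_pos hg]
  · intro μ hμ
    exact C_isBigO hK hμ
  · intro R
    refine ⟨6, 6 * K + 2 * (54 * (2 * Real.log 54 + 1)) + 4 * R ^ 2 + 1, by norm_num, ?_, ?_⟩
    · have := Real.log_nonneg (show (1 : ℝ) ≤ 54 by norm_num)
      positivity
    · intro θ' μ hμ hR hH
      exact ⟨D_lower hK hμ hH, D_upper hK hμ hR hH⟩
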